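/- Let $d\ge 1$ and let $n_1,\dots,n_d>1$ be integers. The grid graph $G$ has vertex set $[n_1]\times\cdots\times[n_d]\subset\mathbb Z^d$, where $[m]=\{1,\dots,m\}$, and two vertices are adjacent when their Manhattan distance is $1$. A robot at a vertex $p$ of $G$ senses (with sensing range $V=1$) the set $S_1(p)=\{p'-p : p'\in G,\ \|p'-p\|_1\le 1\}$. It has one bit of memory $mem\in\{0,1\}$. A $1$-bit algorithm is a function that maps the pair $(S_1(p),mem)$ to the robot's next step (a vector of $\mathbb Z^d$, added to $p$) and its new memory. Let $l_i$ (respectively $r_i$) be the number of elements of $S_1(p)$ whose $i$-th coordinate is negative (respectively positive) and whose other coordinates are $0$. Write $\pm e_i$ for a unit step up or down along axis $i$; $mem$ is unchanged unless a new value is given. The algorithm $\mathrm{MakeMove}$ runs, in dimension $d$, the procedure $\mathrm{MM}_d$ defined as follows. * $\mathrm{MM}_1$. If $mem=0$: step $e_1$ if $r_1\ne0$, else step $-e_1$ and set $mem=1$. If $mem=1$: step $-e_1$ if $l_1\ne0$, else step $e_1$ and set $mem=0$. * $\mathrm{MM}_2$. If $mem=0$: step $e_1$ if $r_1\neq0$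 and $l_2\ne0$; step $-e_1$ if $l_1\ne 0$ and $l_2=0$; step $e_2$ if $l_1=l_2=0$; step $-e_1$ and set $mem=1$ if $r_1=0$ and $l_2r_2\ne0$; step $-e_2$ and set $mem=1$ if $r_1=r_2=0$. If $mem=1$: step $e_2$ and set $mem=0$ if $l_1=0$ and $r_2\ne0$; step $e_1$ and set $mem=0$ if $l_1=r_2=0$; step $-e_1$ if $l_1r_1\ne0$ and $r_2\neq 0$; step $e_1$ if $l_1r_1\ne0$ and $r_2=0$; step $-e_1$ and set $mem=0$ if $r_1=l_2=0$; step $-e_2$ if $r_1=0$ and $l_2\ne0$. * $\mathrm{MM}_3$. If $l_1=r_2=0$ and $mem=0$: set $mem=1$, and step $e_1$ if $r_3=0$, or $e_3$ if $r_3\neq 0$. Otherwise, if $l_1\ne0$, $l_3\neq0$, $r_2=0$ and $mem=1$: step $-e_3$. Otherwise run $\mathrm{MM}_2$. * $\mathrm{MM}_{k+1}$ for $k\ge3$. Suppose $l_2=\dots=l_{k-1}=0$, $r_k=0$ and $mem=1$. If $r_1=0$ and $r_{k+1}=0$, step $-e_1$; if $r_1=0$ and $r_{k+1}\neq0$, step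 $e_{k+1}$ and set $mem=0$; if $r_1\ne0$ and $l_{k+1}\ne0$, step $-e_{k+1}$. In all other cases run $\mathrm{MM}_k$. **Theorem.** For every $d\ge1$ and all $n_1,\dots,n_d>1$, $\mathrm{MakeMove}$, which uses sensing range $V=1$ and $1$ bit of memory and does not depend on $n_1,\dots,n_d$, patrols $G$: from every initial vertex and every initial memory value, the robot moves along an edge of $G$ at every step and visits every vertex of $G$ within finitely many steps. Moreover, it visits every vertex in at most $2|G|$ steps, where $|G|=n_1\cdots n_d$: every vertex occurs among the first $2|G|$ positions of the robot, the initial one included. -/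

import Mathlib

namespace GridPatrol

/-- The vertex set `[n₁] × ⋯ × [n_d]` of the grid graph, where `[m] = {1, …, m}`. The axis numbered
`j` in the mathematics is the index `j - 1 : Fin d`. -/
noncomputable def gridVertices {d : ℕ} (n : Fin d → ℕ) : Finset (Fin d → ℤ) :=
  Fintype.piFinset fun i => Finset.Icc 1 (n i : ℤ)

/-- The Manhattan distance `‖q - p‖₁` on `ℤ^d`. -/
def manhattanDist {d : ℕ} (p q : Fin d → ℤ) : ℕ :=
  ∑ i, (q i - p i).natAbs

theorem manhattanDist_comm {d : ℕ} (p q : Fin d → ℤ) :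
    manhattanDist p q = manhattanDist q p := by
  unfold manhattanDist
  refine Finset.sum_congr rfl fun i _ => ?_
  omega

theorem manhattanDist_self {d : ℕ} (p : Fin d → ℤ) : manhattanDist p p = 0 := by
  simp [manhattanDist]

/-- The grid graph: two vertices are adjacent when their Manhattan distance is `1`. -/
def gridGraph {d : ℕ} (n : Fin d → ℕ) : SimpleGraph {p : Fin d → ℤ // p ∈ gridVertices n} where
  Adj p q := manhattanDist p.1 q.1 = 1
  symm := ⟨fun p q h => by rw [manhattanDist_comm]; exact h⟩
  loopless := ⟨fun p h => by rw [manhattanDist_self] at h; exact zero_ne_one h⟩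

/-- The sensing data at `p` with sensing range `V`: the positions relative to `p` of all
vertices of the grid at Manhattan distance at most `V` from `p`. -/
def sense {d : ℕ} (n : Fin d → ℕ) (V : ℕ) (p : Fin d → ℤ) : Set (Fin d → ℤ) :=
  {u | ∃ q ∈ gridVertices n, manhattanDist p q ≤ V ∧ u = q - p}

/-- The contents of `b` bits of memory. -/
abbrev Memory (b : ℕ) : Type := Fin b → Bool

/-- A deterministic algorithm with `b` bits of memory in dimension `d`: it sees the
current sensing data and the memory, and nothing else, and returns the displacement of the
next step and the new memory. -/
abbrev Algorithm (d b : ℕ) : Type :=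
  Set (Fin d → ℤ) → Memory b → (Fin d → ℤ) × Memory b

/-- One step of the robot, on states (position, memory). -/
def step {d b : ℕ} (n : Fin d → ℕ) (V : ℕ) (alg : Algorithm d b)
    (s : (Fin d → ℤ) × Memory b) : (Fin d → ℤ) × Memory b :=
  (s.1 + (alg (sense n V s.1) s.2).1, (alg (sense n V s.1) s.2).2)

/-- The position after `t` steps, starting at `v` with memory `m`. -/
def position {d b : ℕ} (n : Fin d → ℕ) (V : ℕ) (alg : Algorithm d b)
    (v : Fin d → ℤ) (m : Memory b) (t : ℕ) : Fin d → ℤ :=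
  ((step n V alg)^[t] (v, m)).1

/-- `alg` patrols `L` with sensing range `V`: from every initial position in `L` and every initial
memory, the robot forever moves along edges of the grid graph, and every vertex of `L` is
visited within a finite number of steps. -/
def Patrols {d b : ℕ} (n : Fin d → ℕ) (V : ℕ) (alg : Algorithm d b)
    (L : Set (Fin d → ℤ)) : Prop :=
  ∀ v₁ ∈ L, ∀ m : Memory b,
    (∀ t : ℕ, ∃ (h : position n V alg v₁ m t ∈ gridVertices n)
      (h' : position n V alg v₁ m (t + 1) ∈ gridVertices n),
      (gridGraph n).Adj ⟨position n V alg v₁ m t, h⟩ ⟨position n V alg v₁ m (t + 1), h'⟩) ∧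
    ∃ T : ℕ, ∀ v ∈ L, ∃ t ≤ T, position n V alg v₁ m t = v

/-- The projection of sensing data onto axis `i`. -/
def projection {d : ℕ} (S : Set (Fin d → ℤ)) (i : Fin d) : Set (Fin d → ℤ) :=
  {u ∈ S | ∀ j, j ≠ i → u j = 0}

/-- The lower boundary distance along axis `i`. -/
noncomputable def lowerDist {d : ℕ} (S : Set (Fin d → ℤ)) (i : Fin d) : ℕ :=
  {u ∈ projection S i | u i < 0}.ncard

/-- The upper boundary distance along axis `i`. -/
noncomputable def upperDist {d : ℕ} (S : Set (Fin d → ℤ)) (i : Fin d) : ℕ :=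
  {u ∈ projection S i | 0 < u i}.ncard

/-- Renumber a vector indexed by `Fin d` so that its entries are numbered `1, …, d`
(entries with other numbers are never read). -/
def oneBased {d : ℕ} (f : Fin d → ℕ) (j : ℕ) : ℕ :=
  if h : 1 ≤ j ∧ j ≤ d then f ⟨j - 1, by omega⟩ else 0

/-! In the following procedures axes are numbered from `1`; `l j` and `r j` are the boundary
distances along axis `j`; the memory bits `0` and `1` are `false` and `true`; and the value
`(Pi.single j a, m)` means: move by `a` along axis `j` and set the memory to `m`. -/

/-- The procedure for dimension `1`. -/
def makeMove1D (l r : ℕ → ℕ) (mem : Bool) : (ℕ → ℤ) × Bool :=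
  if mem = false then
    if r 1 ≠ 0 then (Pi.single 1 1, mem)
    else (Pi.single 1 (-1), true)
  else
    if l 1 ≠ 0 then (Pi.single 1 (-1), mem)
    else (Pi.single 1 1, false)

/-- The procedure for dimension `2`. For each value of the memory the listed cases exclude each
other and, when all sides of the grid are longer than `1`, exhaust all possibilities. -/
def makeMove2D (l r : ℕ → ℕ) (mem : Bool) : (ℕ → ℤ) × Bool :=
  if mem = false then
    if r 1 ≠ 0 ∧ l 2 ≠ 0 then (Pi.single 1 1, mem)
    else if l 1 ≠ 0 ∧ l 2 = 0 then (Pi.single 1 (-1), mem)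
    else if l 1 = 0 ∧ l 2 = 0 then (Pi.single 2 1, mem)
    else if r 1 = 0 ∧ l 2 * r 2 ≠ 0 then (Pi.single 1 (-1), true)
    else if r 1 = 0 ∧ r 2 = 0 then (Pi.single 2 (-1), true)
    else (0, mem)
  else
    if l 1 = 0 ∧ r 2 ≠ 0 then (Pi.single 2 1, false)
    else if l 1 = 0 ∧ r 2 = 0 then (Pi.single 1 1, false)
    else if l 1 * r 1 ≠ 0 ∧ r 2 ≠ 0 then (Pi.single 1 (-1), mem)
    else if l 1 * r 1 ≠ 0 ∧ r 2 = 0 then (Pi.single 1 1, mem)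
    else if r 1 = 0 ∧ l 2 = 0 then (Pi.single 1 (-1), false)
    else if r 1 = 0 ∧ l 2 ≠ 0 then (Pi.single 2 (-1), mem)
    else (0, mem)

/-- The procedure for dimension `3`. -/
def makeMove3D (l r : ℕ → ℕ) (mem : Bool) : (ℕ → ℤ) × Bool :=
  if l 1 = 0 ∧ r 2 = 0 ∧ mem = false then
    if r 3 = 0 then (Pi.single 1 1, true)
    else (Pi.single 3 1, true)
  else if (l 1 ≠ 0 ∧ l 3 ≠ 0) ∧ r 2 = 0 ∧ mem = true then (Pi.single 3 (-1), mem)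
  else makeMove2D l r mem

/-- The recursive step: the procedure for dimension `k + 1`, where `k ≥ 3`, in terms of the procedure
`sub` for dimension `k`. -/
def makeMoveSucc (k : ℕ) (sub : (ℕ → ℕ) → (ℕ → ℕ) → Bool → (ℕ → ℤ) × Bool)
    (l r : ℕ → ℕ) (mem : Bool) : (ℕ → ℤ) × Bool :=
  if (∀ j ∈ Finset.Icc 2 (k - 1), l j = 0) ∧ r k = 0 ∧ mem = true then
    if r 1 = 0 then
      if r (k + 1) = 0 then (Pi.single 1 (-1), mem)
      else (Pi.single (k + 1) 1, false)
    else if l (k + 1) ≠ 0 then (Pi.single (k + 1) (-1), mem)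
    else sub l r mem
  else sub l r mem

/-- The recursively defined procedure for dimension `k` (dimension `0` has no meaning). -/
def makeMoveKD : ℕ → (ℕ → ℕ) → (ℕ → ℕ) → Bool → (ℕ → ℤ) × Bool
  | 0 => fun _ _ mem => (0, mem)
  | 1 => makeMove1D
  | 2 => makeMove2D
  | 3 => makeMove3D
  | k + 4 => makeMoveSucc (k + 3) (makeMoveKD (k + 3))

/-- The algorithm `MakeMove` in dimension `d`, with one bit of memory: the procedure for dimension `d`
applied to the boundary distances read off the sensing data. The side lengths of the grid are not
among its inputs. -/
noncomputable def makeMove (d : ℕ) : Algorithm d 1 := fun S mem =>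
  let out := makeMoveKD d (oneBased (lowerDist S)) (oneBased (upperDist S)) (mem 0)
  (fun i => out.1 (i.val + 1), fun _ => out.2)

end GridPatrol

/-! The pair (position, memory) evolves under a deterministic map on a set of 2|G| states. Up to the
first visit to a given state no state repeats, so a state that is reached at all is reached in fewer
than 2|G| steps (`Reaches.exists_lt_card`). It remains to show that every vertex is eventually
visited from every state.

Dimensions 1 and 2 are traced by hand. In the plane the robot follows a closed route: right along
the top row, down the right column, left along the bottom row, then right and back along each
intermediate row until it stands in the upper left corner. All other states flow into this route.

From dimension 3 on, the grid is a stack of planes perpendicular to the last axis, and the robot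
repeats the lower-dimensional tour `f` in each of them (`Tower`). At one exit state `q` it climbs
instead. Climbing flips the memory bit, harmlessly, since `q` and its flipped copy have the same
successor under `f`. In the top plane `q` is sent to `τ`, which differs from `f q` only in the
memory. This wrong bit puts `τ` into a set `T` that `f` never enters from outside, so `T` is free to
mean "descend to the bottom plane". There the walk continues from `τ` and visits the same positions
as the tour from `f q` until the two merge, so the bottom plane is covered as well.

The induction (`Recurrent`) carries along the corner (N 1, 1, …, 1) with memory 1, whose copy in the
top plane is the exit of the next tower. `tower_three` and `tower_succ` provide the towers,
`Recurrent.of_tower` the inductive step, and `extendState_step` the translation to the sensing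
robot. -/

namespace GridPatrol

/-! ### Orbits of a map and the abstract tower argument -/

section Orbits

variable {S : Type*}

/-- Some iterate of `f` carries `s` to `s'`. -/
def Reaches (f : S → S) (s s' : S) : Prop := ∃ t, f^[t] s = s'

theorem Reaches.refl (f : S → S) (s : S) : Reaches f s s := ⟨0, rfl⟩

theorem Reaches.trans {f : S → S} {a b c : S} (h : Reaches f a b) (h' : Reaches f b c) :
    Reaches f a c := by
  obtain ⟨t, rfl⟩ := h
  obtain ⟨t', rfl⟩ := h'
  exact ⟨t' + t, Function.iterate_add_apply f t' t a⟩

theorem Reaches.of_eq {f : S → S} {a b : S} (h : f a = b) : Reaches f a b := ⟨1, h⟩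

theorem Reaches.head {f : S → S} {a b c : S} (h : f a = b) (h' : Reaches f b c) :
    Reaches f a c := (Reaches.of_eq h).trans h'

theorem Reaches.ascend {f : S → S} {F : ℤ → S} {a b : ℤ} (hab : a ≤ b)
    (h : ∀ u, a ≤ u → u < b → Reaches f (F u) (F (u + 1))) : Reaches f (F a) (F b) := by
  induction b, hab using Int.leInduction with
  | base => exact Reaches.refl f _
  | succ b hab ih => exact (ih fun u h1 h2 => h u h1 (by omega)).trans (h b hab (by omega))

theorem Reaches.descend {f : S → S} {F : ℤ → S} {a b : ℤ} (hab : a ≤ b)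
    (h : ∀ u, a < u → u ≤ b → Reaches f (F u) (F (u - 1))) : Reaches f (F b) (F a) := by
  induction b, hab using Int.leInduction with
  | base => exact Reaches.refl f _
  | succ b hab ih =>
    have h1 := h (b + 1) (by omega) le_rfl
    rw [add_sub_cancel_right] at h1
    exact h1.trans (ih fun u h1 h2 => h u h1 (by omega))

theorem mapsTo_iterate {f : S → S} {V : Set S} (hV : ∀ s ∈ V, f s ∈ V) {s : S} (hs : s ∈ V)
    (t : ℕ) : f^[t] s ∈ V := by
  induction t with
  | zero => exact hs
  | succ t ih => rw [Function.iterate_succ_apply']; exact hV _ ih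

/-- In a finite invariant set, everything that is reached is reached soon. -/
theorem Reaches.exists_lt_card [DecidableEq S] {f : S → S} {A : Finset S}
    (hA : ∀ s ∈ A, f s ∈ A) {s s' : S} (hs : s ∈ A) (h : Reaches f s s') :
    ∃ t < A.card, f^[t] s = s' := by
  classical
  refine ⟨Nat.find h, ?_, Nat.find_spec h⟩
  have hinj : Set.InjOn (fun t => f^[t] s) (Finset.range (Nat.find h + 1) : Finset ℕ) := by
    have key : ∀ i j, i < j → j ≤ Nat.find h → f^[i] s ≠ f^[j] s := by
      intro i j hij hj he
      refine Nat.find_min h (m := Nat.find h - j + i) (by omega) ?_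
      rw [Function.iterate_add_apply, he, ← Function.iterate_add_apply,
        Nat.sub_add_cancel hj]
      exact Nat.find_spec h
    intro i hi j hj he
    simp only [Finset.coe_range, Set.mem_Iio] at hi hj
    rcases lt_trichotomy i j with hij | hij | hij
    · exact absurd he (key i j hij (by omega))
    · exact hij
    · exact absurd he.symm (key j i hij (by omega))
  have := Finset.card_le_card_of_injOn (t := A) (fun t => f^[t] s)
    (fun t _ => mapsTo_iterate (V := (A : Set S)) hA hs t) hinj
  rw [Finset.card_range] at this
  omega

/-- `g` patrols a stack of `n` planes `lift 1, …, lift n`, following `f` inside each of them: from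
the exit `q` of a plane it climbs to the next one, from the exit of the top plane it moves to a
state `τ` in the set `T` of states in which it descends to the bottom plane. The states of `T` are
shadowed through `R` by states that `f` reaches from `q`. -/
structure Tower (f g : S → S) (V : Set S) (lift : ℤ → S → S) (n : ℤ) (q τ : S) (T : Set S)
    (R : S → S → Prop) : Prop where
  two_le : 2 ≤ n
  mapsTo : ∀ s ∈ V, f s ∈ V
  exit_mem : q ∈ V
  descent_mem : τ ∈ V
  exit_notMem : q ∉ T
  descent_start : τ ∈ T
  transient : ∀ s ∈ V, s ∉ T → f s ∉ T
  inside : ∀ s ∈ V, ∀ z, 1 ≤ z → z ≤ n → s ≠ q → (s ∈ T → z = 1) → g (lift z s) = lift z (f s)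
  down : ∀ s ∈ V, s ∈ T → ∀ z, 1 < z → z ≤ n → g (lift z s) = lift (z - 1) s
  up : ∀ z, 1 ≤ z → z < n → g (g (lift z q)) = lift (z + 1) (f q)
  top : g (lift n q) = lift n τ
  shadow_start : R τ (f q)
  shadow_step : ∀ s ∈ V, ∀ s', R s s' → R (f s) (f s')
  shadow_exit : ∀ s', R q s' → s' = q
  exit_reached : ∀ s ∈ V, Reaches f s q

namespace Tower

variable {f g : S → S} {V : Set S} {lift : ℤ → S → S} {n : ℤ} {q τ : S} {T : Set S}
  {R : S → S → Prop}
-- Take the first arrival at `s`: a passage through `q` would restart the orbit at `f q` and yield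
-- an earlier one.
theorem exists_iterate_avoiding {s : S} (hr : Reaches f (f q) s) :
    ∃ t, f^[t] (f q) = s ∧ ∀ j < t, f^[j] (f q) ≠ q := by
  classical
  refine ⟨Nat.find hr, Nat.find_spec hr, fun j hj hq => ?_⟩
  refine Nat.find_min hr (m := Nat.find hr - j - 1) (by omega) ?_
  have h1 : f^[(Nat.find hr - j - 1).succ] (f^[j] (f q)) = s := by
    rw [← Function.iterate_add_apply, show (Nat.find hr - j - 1).succ + j = Nat.find hr by omega]
    exact Nat.find_spec hr
  rw [hq] at h1
  exact h1

/-- Above the bottom plane an orbit that starts outside `T` stays outside, and in the bottom plane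
`T` causes no descent. Hence until `q` is met only the field `inside` applies. -/
theorem iterate_inside (h : Tower f g V lift n q τ T R)
    {s : S} (hs : s ∈ V) {z : ℤ} (hz : 1 ≤ z) (hzn : z ≤ n)
    (hT : s ∈ T → z = 1) (t : ℕ) (ht : ∀ j < t, f^[j] s ≠ q) :
    g^[t] (lift z s) = lift z (f^[t] s) ∧ (f^[t] s ∈ T → z = 1) := by
  induction t with
  | zero => exact ⟨rfl, hT⟩
  | succ t ih =>
    obtain ⟨ih1, ih2⟩ := ih fun j hj => ht j (by omega)
    have hm := mapsTo_iterate h.mapsTo hs t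
    rw [Function.iterate_succ_apply', Function.iterate_succ_apply', ih1,
      h.inside _ hm z hz hzn (ht t (by omega)) ih2]
    refine ⟨rfl, fun hT' => ?_⟩
    by_contra hz1
    exact h.transient _ hm (fun h' => hz1 (ih2 h')) hT'

theorem reaches_exit_inside (h : Tower f g V lift n q τ T R)
    {s : S} (hs : s ∈ V) {z : ℤ} (hz : 1 ≤ z) (hzn : z ≤ n)
    (hT : s ∈ T → z = 1) : Reaches g (lift z s) (lift z q) := by
  classical
  have hr := h.exit_reached s hs
  refine ⟨Nat.find hr, ?_⟩
  rw [(h.iterate_inside hs hz hzn hT _ fun j hj => Nat.find_min hr hj).1, Nat.find_spec hr]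

theorem reaches_bottom (h : Tower f g V lift n q τ T R)
    {s : S} (hs : s ∈ V) (hT : s ∈ T) {z : ℤ} (hz : 1 ≤ z) (hzn : z ≤ n) :
    Reaches g (lift z s) (lift 1 s) :=
  Reaches.descend (F := fun z => lift z s) hz fun u h1 h2 =>
    Reaches.of_eq (h.down s hs hT u h1 (by omega))

theorem reaches_above (h : Tower f g V lift n q τ T R)
    {z : ℤ} (hz : 1 ≤ z) (hzn : z < n) :
    Reaches g (lift z q) (lift (z + 1) (f q)) := ⟨2, h.up z hz hzn⟩

theorem reaches_exit_above (h : Tower f g V lift n q τ T R)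
    {z z' : ℤ} (hz : 1 ≤ z) (hzz' : z ≤ z') (hz' : z' ≤ n) :
    Reaches g (lift z q) (lift z' q) :=
  Reaches.ascend (F := fun z => lift z q) hzz' fun u h1 h2 =>
    (h.reaches_above (by omega) (by omega)).trans
      (h.reaches_exit_inside (h.mapsTo _ h.exit_mem) (by omega) (by omega)
        fun hT => absurd hT (h.transient _ h.exit_mem h.exit_notMem))

/-- `lift 1 τ` is a common meeting point of all orbits: every state reaches the exit of some plane,
climbs to the top exit, and drops to the bottom from there. -/
theorem reaches_descent (h : Tower f g V lift n q τ T R)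
    {s : S} (hs : s ∈ V) {z : ℤ} (hz : 1 ≤ z) (hzn : z ≤ n) :
    Reaches g (lift z s) (lift 1 τ) := by
  have hn := h.two_le
  have hexit : ∀ z, 1 ≤ z → z ≤ n → Reaches g (lift z q) (lift 1 τ) := by
    intro z hz hzn
    exact (h.reaches_exit_above hz hzn le_rfl).trans (Reaches.head h.top
      (h.reaches_bottom h.descent_mem h.descent_start (by omega) le_rfl))
  by_cases hT : s ∈ T
  · exact (h.reaches_bottom hs hT hz hzn).trans
      ((h.reaches_exit_inside hs le_rfl (by omega) fun _ => rfl).trans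
        (hexit 1 le_rfl (by omega)))
  · exact (h.reaches_exit_inside hs hz hzn fun hT' => absurd hT' hT).trans (hexit z hz hzn)

/-- Planes other than the bottom one are entered from below at `f q`. From there the part of the
`f`-orbit before the next passage through `q` is copied verbatim. -/
theorem reaches_lift (h : Tower f g V lift n q τ T R)
    {s₀ s : S} (hs₀ : s₀ ∈ V) (hr : Reaches f (f q) s) {z₀ z : ℤ}
    (hz₀ : 1 ≤ z₀) (hzn₀ : z₀ ≤ n) (hz : 2 ≤ z) (hzn : z ≤ n) :
    Reaches g (lift z₀ s₀) (lift z s) := by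
  obtain ⟨t, ht, hav⟩ := exists_iterate_avoiding hr
  have hn := h.two_le
  have h1 := (h.reaches_descent hs₀ hz₀ hzn₀).trans
    (h.reaches_exit_inside h.descent_mem le_rfl (by omega) fun _ => rfl)
  have h2 := h.reaches_exit_above le_rfl (show 1 ≤ z - 1 by omega) (by omega)
  have h3 := h.reaches_above (z := z - 1) (by omega) (by omega)
  rw [sub_add_cancel] at h3
  refine h1.trans (h2.trans (h3.trans ⟨t, ?_⟩))
  rw [(h.iterate_inside (h.mapsTo _ h.exit_mem) (by omega) hzn
    (fun hT => absurd hT (h.transient _ h.exit_mem h.exit_notMem)) t hav).1, ht]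

/-- The bottom plane is entered from above, at `τ` instead of `f q`, so only a shadow of `s` is
obtained. -/
theorem reaches_lift_one (h : Tower f g V lift n q τ T R)
    {s : S} (hr : Reaches f (f q) s) :
    ∃ s', R s' s ∧ ∀ s₀ ∈ V, ∀ z₀, 1 ≤ z₀ → z₀ ≤ n → Reaches g (lift z₀ s₀) (lift 1 s') := by
  obtain ⟨t, ht, hav⟩ := exists_iterate_avoiding hr
  have hn := h.two_le
  have hR : ∀ j, R (f^[j] τ) (f^[j] (f q)) := by
    intro j
    induction j with
    | zero => exact h.shadow_start
    | succ j ih =>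
      rw [Function.iterate_succ_apply', Function.iterate_succ_apply']
      exact h.shadow_step _ (mapsTo_iterate h.mapsTo h.descent_mem j) _ ih
  refine ⟨f^[t] τ, ht ▸ hR t, fun s₀ hs₀ z₀ hz₀ hzn₀ =>
    (h.reaches_descent hs₀ hz₀ hzn₀).trans ⟨t, ?_⟩⟩
  refine (h.iterate_inside h.descent_mem le_rfl (by omega) (fun _ => rfl) t ?_).1
  -- By `shadow_exit`, the shadow cannot leave the plane before the orbit of `f q` meets `q`.
  intro j hj hq
  exact hav j hj (h.shadow_exit _ (hq ▸ hR j))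

end Tower

end Orbits

/-! ### The procedure on integer sequences, with all dimensions in one state space -/

section Procedure

/-- Whether there is room below `p` along each axis (`1` or `0`), as the robot senses it. -/
def lowerRoom (p : ℕ → ℤ) (j : ℕ) : ℕ := if 1 < p j then 1 else 0

/-- Whether there is room above `p` along each axis (`1` or `0`), as the robot senses it. -/
def upperRoom (N p : ℕ → ℤ) (j : ℕ) : ℕ := if p j < N j then 1 else 0

theorem lowerRoom_eq_zero {p : ℕ → ℤ} {j : ℕ} : lowerRoom p j = 0 ↔ p j ≤ 1 := by
  simp [lowerRoom]

theorem upperRoom_eq_zero {N p : ℕ → ℤ} {j : ℕ} : upperRoom N p j = 0 ↔ N j ≤ p j := by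
  simp [upperRoom]

/-- One step of the procedure for dimension `k` on states (position, memory), in the grid with sides
`N 1, …, N k`; the other coordinates are ignored. -/
def kdStep (N : ℕ → ℤ) (k : ℕ) (s : (ℕ → ℤ) × Bool) : (ℕ → ℤ) × Bool :=
  (s.1 + (makeMoveKD k (lowerRoom s.1) (upperRoom N s.1) s.2).1,
    (makeMoveKD k (lowerRoom s.1) (upperRoom N s.1) s.2).2)

/-- The vertices of the grid with sides `N 1, …, N k`, with all other coordinates equal to `1`. -/
def box (N : ℕ → ℤ) (k : ℕ) : Set (ℕ → ℤ) :=
  {p | ∀ j, 1 ≤ p j ∧ p j ≤ if 1 ≤ j ∧ j ≤ k then N j else 1}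

/-- Only the axes 1, …, k are read. This allows lifting into planes and replacing sensed data by
room indicators. -/
theorem makeMoveKD_congr (k : ℕ) {l l' r r' : ℕ → ℕ} (m : Bool)
    (hl : ∀ j, 1 ≤ j → j ≤ k → l j = l' j) (hr : ∀ j, 1 ≤ j → j ≤ k → r j = r' j) :
    makeMoveKD k l r m = makeMoveKD k l' r' m := by
  induction k with
  | zero => rfl
  | succ k ih =>
    have ih := ih (fun j h1 h2 => hl j h1 (by omega)) (fun j h1 h2 => hr j h1 (by omega))
    match k, ih with
    | 0, _ => simp only [makeMoveKD, makeMove1D, hl 1 le_rfl le_rfl, hr 1 le_rfl le_rfl]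
    | 1, _ =>
      simp only [makeMoveKD, makeMove2D, hl 1 le_rfl (by omega), hr 1 le_rfl (by omega),
        hl 2 (by omega) le_rfl, hr 2 (by omega) le_rfl]
    | 2, ih =>
      simp only [makeMoveKD] at ih
      simp only [makeMoveKD, makeMove3D, ih, hl 1 le_rfl (by omega), hl 3 (by omega) le_rfl,
        hr 2 (by omega) (by omega), hr 3 (by omega) le_rfl]
    | k + 3, ih =>
      have hc : (∀ j ∈ Finset.Icc 2 (k + 3 - 1), l j = 0) ↔
          ∀ j ∈ Finset.Icc 2 (k + 3 - 1), l' j = 0 := by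
        refine forall₂_congr fun j hj => ?_
        rw [Finset.mem_Icc] at hj
        rw [hl j (by omega) (by omega)]
      simp only [makeMoveKD, makeMoveSucc, ih, hc, hr (k + 3) (by omega) (by omega),
        hr 1 (by omega) (by omega), hr (k + 3 + 1) (by omega) le_rfl,
        hl (k + 3 + 1) (by omega) le_rfl]

/-- Every move is a unit step along one of the axes `1, …, k` and stays inside the grid. -/
theorem makeMoveKD_valid {N : ℕ → ℤ} (hN : ∀ j, 2 ≤ N j) {k : ℕ} (hk : 1 ≤ k) {p : ℕ → ℤ}
    (hp : ∀ j, 1 ≤ j → j ≤ k → 1 ≤ p j ∧ p j ≤ N j) (m : Bool) :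
    ∃ i, 1 ≤ i ∧ i ≤ k ∧ ∃ e : ℤ, (e = 1 ∨ e = -1) ∧ 1 ≤ p i + e ∧ p i + e ≤ N i ∧
      (makeMoveKD k (lowerRoom p) (upperRoom N p) m).1 = Pi.single i e := by
  -- Reduces each leaf of the case analysis, an explicit move, to linear inequalities.
  have aux : ∀ {k i : ℕ} {e : ℤ} {m : Bool} (_ : 1 ≤ i) (_ : i ≤ k) (_ : e = 1 ∨ e = -1)
      (_ : 1 ≤ p i + e) (_ : p i + e ≤ N i),
      ∃ i', 1 ≤ i' ∧ i' ≤ k ∧ ∃ e' : ℤ, (e' = 1 ∨ e' = -1) ∧ 1 ≤ p i' + e' ∧ p i' + e' ≤ N i' ∧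
        ((Pi.single i e, m) : (ℕ → ℤ) × Bool).1 = Pi.single i' e' :=
    fun h1 h2 h3 h4 h5 => ⟨_, h1, h2, _, h3, h4, h5, rfl⟩
  have h1 := hN 1
  have h2 := hN 2
  induction k with
  | zero => omega
  | succ k ih =>
    match k, ih with
    | 0, _ =>
      have p1 := hp 1 le_rfl le_rfl
      simp only [makeMoveKD, makeMove1D, ne_eq, lowerRoom_eq_zero, upperRoom_eq_zero]
      split_ifs <;> apply aux <;> omega
    | 1, _ =>
      have p1 := hp 1 le_rfl (by omega)
      have p2 := hp 2 (by omega) le_rfl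
      simp only [makeMoveKD, makeMove2D, ne_eq, mul_eq_zero, lowerRoom_eq_zero, upperRoom_eq_zero]
      cases m <;> simp only [if_true, if_false, Bool.true_eq_false] <;>
        split_ifs <;> first | (exfalso; omega) | (apply aux <;> omega)
    | 2, ih =>
      obtain ⟨i, hi1, hi2, e, he⟩ := ih (by omega) fun j h1 h2 => hp j h1 (by omega)
      have p1 := hp 1 le_rfl (by omega)
      have p3 := hp 3 (by omega) le_rfl
      simp only [makeMoveKD, makeMove3D, ne_eq, lowerRoom_eq_zero, upperRoom_eq_zero] at he ⊢
      split_ifs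
      · apply aux <;> omega
      · apply aux <;> omega
      · apply aux <;> omega
      · exact ⟨i, hi1, by omega, e, he⟩
    | k + 3, ih =>
      obtain ⟨i, hi1, hi2, e, he⟩ := ih (by omega) fun j h1 h2 => hp j h1 (by omega)
      have p1 := hp 1 le_rfl (by omega)
      have pk := hp (k + 3 + 1) (by omega) le_rfl
      simp only [makeMoveKD, makeMoveSucc, ne_eq, lowerRoom_eq_zero, upperRoom_eq_zero] at he ⊢
      split_ifs
      · apply aux <;> omega
      · apply aux <;> omega
      · exact ⟨i, hi1, by omega, e, he⟩
      · apply aux <;> omega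
      · exact ⟨i, hi1, by omega, e, he⟩

theorem box_bounds {N : ℕ → ℤ} {k : ℕ} {p : ℕ → ℤ} (hp : p ∈ box N k) (j : ℕ) (h1 : 1 ≤ j)
    (h2 : j ≤ k) : 1 ≤ p j ∧ p j ≤ N j := by
  have := hp j
  rwa [if_pos ⟨h1, h2⟩] at this

theorem box_eq_one {N : ℕ → ℤ} {k : ℕ} {p : ℕ → ℤ} (hp : p ∈ box N k) {j : ℕ}
    (hj : ¬(1 ≤ j ∧ j ≤ k)) : p j = 1 := by
  have := hp j
  rw [if_neg hj] at this
  omega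

theorem kdStep_mem_box {N : ℕ → ℤ} (hN : ∀ j, 2 ≤ N j) {k : ℕ} (hk : 1 ≤ k)
    {s : (ℕ → ℤ) × Bool} (hs : s.1 ∈ box N k) : (kdStep N k s).1 ∈ box N k := by
  obtain ⟨i, hi1, hi2, e, -, h1, h2, h3⟩ := makeMoveKD_valid hN hk (box_bounds hs) s.2
  intro j
  simp only [kdStep, h3, Pi.add_apply]
  by_cases hj : j = i
  · subst hj
    rw [Pi.single_eq_same, if_pos ⟨hi1, hi2⟩]
    exact ⟨h1, h2⟩
  · rw [Pi.single_eq_of_ne hj, add_zero]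
    exact hs j

/-- Put a state of a plane perpendicular to axis `j` into the plane with `j`-th coordinate `z`. -/
def lift (j : ℕ) (z : ℤ) (s : (ℕ → ℤ) × Bool) : (ℕ → ℤ) × Bool :=
  (Function.update s.1 j z, s.2)

theorem lift_mem_box {N : ℕ → ℤ} {k : ℕ} {z : ℤ} {s : (ℕ → ℤ) × Bool} (hs : s.1 ∈ box N k)
    (hz : 1 ≤ z) (hzn : z ≤ N (k + 1)) : (lift (k + 1) z s).1 ∈ box N (k + 1) := by
  intro j
  by_cases hj : j = k + 1
  · subst hj
    simpa [lift] using ⟨hz, hzn⟩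
  · have := hs j
    simp only [lift, Function.update_of_ne hj]
    rwa [if_congr (P := 1 ≤ j ∧ j ≤ k + 1) (Q := 1 ≤ j ∧ j ≤ k) (by omega) rfl rfl]

theorem exists_eq_lift {N : ℕ → ℤ} {k : ℕ} {s : (ℕ → ℤ) × Bool}
    (hs : s.1 ∈ box N (k + 1)) :
    ∃ s' : (ℕ → ℤ) × Bool, s'.1 ∈ box N k ∧ ∃ z, 1 ≤ z ∧ z ≤ N (k + 1) ∧ lift (k + 1) z s' = s := by
  have hb := box_bounds hs (k + 1) (by omega) le_rfl
  refine ⟨(Function.update s.1 (k + 1) 1, s.2), ?_, s.1 (k + 1), hb.1, hb.2, ?_⟩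
  · intro j
    by_cases hj : j = k + 1
    · subst hj
      simp
    · have := hs j
      simp only [Function.update_of_ne hj]
      rwa [if_congr (P := 1 ≤ j ∧ j ≤ k) (Q := 1 ≤ j ∧ j ≤ k + 1) (by omega) rfl rfl]
  · simp [lift]

/-- The procedure for dimension k neither reads nor changes a coordinate beyond k. -/
theorem kdStep_lift {N : ℕ → ℤ} (hN : ∀ j, 2 ≤ N j) {k : ℕ} (hk : 1 ≤ k) {s : (ℕ → ℤ) × Bool}
    (hs : s.1 ∈ box N k) {j : ℕ} (hj : k < j) (z : ℤ) :
    kdStep N k (lift j z s) = lift j z (kdStep N k s) := by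
  have hc : makeMoveKD k (lowerRoom (lift j z s).1) (upperRoom N (lift j z s).1) (lift j z s).2 =
      makeMoveKD k (lowerRoom s.1) (upperRoom N s.1) s.2 := by
    refine makeMoveKD_congr k _ (fun i _ hi => ?_) fun i _ hi => ?_
    · simp [lowerRoom, lift, Function.update_of_ne (show i ≠ j by omega)]
    · simp [upperRoom, lift, Function.update_of_ne (show i ≠ j by omega)]
  obtain ⟨i, -, hi, e, -, -, -, he⟩ := makeMoveKD_valid hN hk (box_bounds hs) s.2
  unfold kdStep
  rw [hc, he]
  refine Prod.ext (funext fun x => ?_) rfl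
  by_cases hx : x = j
  · subst hx
    simp [lift, Pi.single_eq_of_ne (show x ≠ i by omega)]
  · simp [lift, Function.update_of_ne hx]

/-- Either the procedure for dimension `k + 1` does what the one for dimension `k` does, or it
moves inside the upper face of axis `k`. -/
theorem kdStep_succ (N : ℕ → ℤ) {k : ℕ} (hk : 2 ≤ k) (s : (ℕ → ℤ) × Bool) :
    kdStep N (k + 1) s = kdStep N k s ∨ (N k ≤ s.1 k ∧ (kdStep N (k + 1) s).1 k = s.1 k) := by
  match k, hk with
  | 2, _ =>
    simp only [kdStep, makeMoveKD, makeMove3D, ne_eq, lowerRoom_eq_zero, upperRoom_eq_zero]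
    split_ifs with h1 h2 h3 <;> simp_all
  | k + 3, _ =>
    simp only [kdStep, makeMoveKD, makeMoveSucc, ne_eq, lowerRoom_eq_zero, upperRoom_eq_zero]
    split_ifs with h1 h2 h3 h4 <;> simp_all

/-- Each level above dimension 2 intervenes only on the upper face of the preceding axis. -/
theorem kdStep_eq_two (N : ℕ → ℤ) (k : ℕ) (s : (ℕ → ℤ) × Bool)
    (h : ∀ j, 2 ≤ j → j < k + 2 → s.1 j < N j) : kdStep N (k + 2) s = kdStep N 2 s := by
  induction k with
  | zero => rfl
  | succ k ih =>
    have ih := ih fun j h1 h2 => h j h1 (by omega)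
    rcases kdStep_succ N (show 2 ≤ k + 2 by omega) s with h1 | ⟨h1, -⟩
    · exact h1.trans ih
    · have := h (k + 2) (by omega) (by omega)
      omega

/-- An intervening move stays in that upper face, so it can be ruled out from its endpoint as well
as from its start. -/
theorem kdStep_eq_two_of_image (N : ℕ → ℤ) (k : ℕ) (s : (ℕ → ℤ) × Bool)
    (h : ∀ j, 2 ≤ j → j < k + 2 → (kdStep N (k + 2) s).1 j < N j) :
    kdStep N (k + 2) s = kdStep N 2 s := by
  induction k with
  | zero => rfl
  | succ k ih =>
    rcases kdStep_succ N (show 2 ≤ k + 2 by omega) s with h1 | ⟨h1, h2⟩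
    · have h1 : kdStep N (k + 1 + 2) s = kdStep N (k + 2) s := h1
      rw [h1] at h ⊢
      exact ih fun j h1 h2 => h j h1 (by omega)
    · have := h (k + 2) (by omega) (by omega)
      have h2 : (kdStep N (k + 1 + 2) s).1 (k + 2) = s.1 (k + 2) := h2
      omega

end Procedure

/-! ### The closed route in dimension 2 -/

section Plane

variable {N p : ℕ → ℤ}

theorem kdStep_two_false_right (h1 : p 1 < N 1) (h2 : 1 < p 2) :
    kdStep N 2 (p, false) = (p + Pi.single 1 1, false) := by
  simp only [kdStep, makeMoveKD, makeMove2D, ne_eq, lowerRoom_eq_zero, upperRoom_eq_zero]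
  split_ifs <;> first | rfl | (exfalso; omega)

theorem kdStep_two_false_left (h1 : 1 < p 1) (h2 : p 2 ≤ 1) :
    kdStep N 2 (p, false) = (p + Pi.single 1 (-1), false) := by
  simp only [kdStep, makeMoveKD, makeMove2D, ne_eq, lowerRoom_eq_zero, upperRoom_eq_zero]
  split_ifs <;> first | rfl | (exfalso; omega)

theorem kdStep_two_false_up (h1 : p 1 ≤ 1) (h2 : p 2 ≤ 1) :
    kdStep N 2 (p, false) = (p + Pi.single 2 1, false) := by
  simp only [kdStep, makeMoveKD, makeMove2D, ne_eq, lowerRoom_eq_zero, upperRoom_eq_zero]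
  split_ifs <;> first | rfl | (exfalso; omega)

theorem kdStep_two_false_turn (h1 : N 1 ≤ p 1) (h2 : 1 < p 2) (h3 : p 2 < N 2) :
    kdStep N 2 (p, false) = (p + Pi.single 1 (-1), true) := by
  simp only [kdStep, makeMoveKD, makeMove2D, ne_eq, mul_eq_zero, lowerRoom_eq_zero,
    upperRoom_eq_zero]
  split_ifs <;> first | rfl | (exfalso; omega)

theorem kdStep_two_false_down (h1 : N 1 ≤ p 1) (h2 : 1 < p 2) (h3 : N 2 ≤ p 2) :
    kdStep N 2 (p, false) = (p + Pi.single 2 (-1), true) := by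
  simp only [kdStep, makeMoveKD, makeMove2D, ne_eq, mul_eq_zero, lowerRoom_eq_zero,
    upperRoom_eq_zero]
  split_ifs <;> first | rfl | (exfalso; omega)

theorem kdStep_two_true_up (h1 : p 1 ≤ 1) (h2 : p 2 < N 2) :
    kdStep N 2 (p, true) = (p + Pi.single 2 1, false) := by
  simp only [kdStep, makeMoveKD, makeMove2D, ne_eq, mul_eq_zero, lowerRoom_eq_zero,
    upperRoom_eq_zero, Bool.true_eq_false, if_false]
  split_ifs <;> first | rfl | (exfalso; omega)

theorem kdStep_two_true_turn (h1 : p 1 ≤ 1) (h2 : N 2 ≤ p 2) :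
    kdStep N 2 (p, true) = (p + Pi.single 1 1, false) := by
  simp only [kdStep, makeMoveKD, makeMove2D, ne_eq, mul_eq_zero, lowerRoom_eq_zero,
    upperRoom_eq_zero, Bool.true_eq_false, if_false]
  split_ifs <;> first | rfl | (exfalso; omega)

theorem kdStep_two_true_left (h1 : 1 < p 1) (h2 : p 1 < N 1) (h3 : p 2 < N 2) :
    kdStep N 2 (p, true) = (p + Pi.single 1 (-1), true) := by
  simp only [kdStep, makeMoveKD, makeMove2D, ne_eq, mul_eq_zero, lowerRoom_eq_zero,
    upperRoom_eq_zero, Bool.true_eq_false, if_false]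
  split_ifs <;> first | rfl | (exfalso; omega)

theorem kdStep_two_true_right (h1 : 1 < p 1) (h2 : p 1 < N 1) (h3 : N 2 ≤ p 2) :
    kdStep N 2 (p, true) = (p + Pi.single 1 1, true) := by
  simp only [kdStep, makeMoveKD, makeMove2D, ne_eq, mul_eq_zero, lowerRoom_eq_zero,
    upperRoom_eq_zero, Bool.true_eq_false, if_false]
  split_ifs <;> first | rfl | (exfalso; omega)

theorem kdStep_two_true_corner (h1 : 1 < p 1) (h2 : N 1 ≤ p 1) (h3 : p 2 ≤ 1) :
    kdStep N 2 (p, true) = (p + Pi.single 1 (-1), false) := by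
  simp only [kdStep, makeMoveKD, makeMove2D, ne_eq, mul_eq_zero, lowerRoom_eq_zero,
    upperRoom_eq_zero, Bool.true_eq_false, if_false]
  split_ifs <;> first | rfl | (exfalso; omega)

theorem kdStep_two_true_down (h1 : 1 < p 1) (h2 : N 1 ≤ p 1) (h3 : 1 < p 2) :
    kdStep N 2 (p, true) = (p + Pi.single 2 (-1), true) := by
  simp only [kdStep, makeMoveKD, makeMove2D, ne_eq, mul_eq_zero, lowerRoom_eq_zero,
    upperRoom_eq_zero, Bool.true_eq_false, if_false]
  split_ifs <;> first | rfl | (exfalso; omega)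

/-- The point with first two coordinates `x`, `y` and all others equal to `1`. -/
def planePoint (x y : ℤ) (j : ℕ) : ℤ := if j = 1 then x else if j = 2 then y else 1

@[simp] theorem planePoint_one (x y : ℤ) : planePoint x y 1 = x := rfl

@[simp] theorem planePoint_two (x y : ℤ) : planePoint x y 2 = y := rfl

theorem planePoint_of_three_le (x y : ℤ) {j : ℕ} (hj : 3 ≤ j) : planePoint x y j = 1 := by
  rw [planePoint, if_neg (by omega), if_neg (by omega)]

theorem planePoint_add_one (x y a : ℤ) :
    planePoint x y + Pi.single 1 a = planePoint (x + a) y := by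
  funext j
  by_cases h1 : j = 1
  · subst h1; simp
  · simp [planePoint, h1]

theorem planePoint_add_two (x y a : ℤ) :
    planePoint x y + Pi.single 2 a = planePoint x (y + a) := by
  funext j
  by_cases h2 : j = 2
  · subst h2; simp
  · simp [planePoint, h2]

theorem planePoint_mem_box (hN : ∀ j, 2 ≤ N j) {k : ℕ} (hk : 2 ≤ k) {x y : ℤ} (hx : 1 ≤ x)
    (hx' : x ≤ N 1) (hy : 1 ≤ y) (hy' : y ≤ N 2) : planePoint x y ∈ box N k := by
  intro j
  have := hN j
  unfold planePoint
  split_ifs <;> first | omega | (subst_vars; omega)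

theorem eq_planePoint (hp : p ∈ box N 2) : p = planePoint (p 1) (p 2) := by
  funext j
  unfold planePoint
  split_ifs with h1 h2
  · rw [h1]
  · rw [h2]
  · exact box_eq_one hp (by omega)

theorem reaches_right_of_false {x x' y : ℤ} (hxx' : x ≤ x') (hx' : x' ≤ N 1) (hy : 2 ≤ y) :
    Reaches (kdStep N 2) (planePoint x y, false) (planePoint x' y, false) :=
  Reaches.ascend (F := fun u => (planePoint u y, false)) hxx' fun u h1 h2 => Reaches.of_eq <| by
    rw [kdStep_two_false_right (by simp; omega) (by simp; omega), planePoint_add_one]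

theorem reaches_left_of_false {x x' : ℤ} (hx' : 1 ≤ x') (hxx' : x' ≤ x) :
    Reaches (kdStep N 2) (planePoint x 1, false) (planePoint x' 1, false) :=
  Reaches.descend (F := fun u => (planePoint u 1, false)) hxx' fun u h1 h2 => Reaches.of_eq <| by
    rw [kdStep_two_false_left (by simp; omega) (by simp), planePoint_add_one, sub_eq_add_neg]

theorem reaches_left_of_true {x x' y : ℤ} (hx' : 1 ≤ x') (hxx' : x' ≤ x) (hx : x < N 1)
    (hy : y < N 2) : Reaches (kdStep N 2) (planePoint x y, true) (planePoint x' y, true) :=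
  Reaches.descend (F := fun u => (planePoint u y, true)) hxx' fun u h1 h2 => Reaches.of_eq <| by
    rw [kdStep_two_true_left (by simp; omega) (by simp; omega) (by simpa), planePoint_add_one,
      sub_eq_add_neg]

theorem reaches_right_of_true {x x' : ℤ} (hx : 2 ≤ x) (hxx' : x ≤ x') (hx' : x' ≤ N 1) :
    Reaches (kdStep N 2) (planePoint x (N 2), true) (planePoint x' (N 2), true) :=
  Reaches.ascend (F := fun u => (planePoint u (N 2), true)) hxx' fun u h1 h2 =>
    Reaches.of_eq <| by
      rw [kdStep_two_true_right (by simp; omega) (by simp; omega) (by simp), planePoint_add_one]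

theorem reaches_second_row {x : ℤ} (hx : 1 ≤ x) :
    Reaches (kdStep N 2) (planePoint x 1, false) (planePoint 1 2, false) := by
  refine (reaches_left_of_false le_rfl hx).trans (Reaches.of_eq ?_)
  rw [kdStep_two_false_up (by simp) (by simp), planePoint_add_two]
  rfl

theorem reaches_down_of_true (hN : ∀ j, 2 ≤ N j) {y y' : ℤ} (hy' : 1 ≤ y') (hyy' : y' ≤ y) :
    Reaches (kdStep N 2) (planePoint (N 1) y, true) (planePoint (N 1) y', true) :=
  Reaches.descend (F := fun u => (planePoint (N 1) u, true)) hyy' fun u h1 h2 =>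
    Reaches.of_eq <| by
      rw [kdStep_two_true_down (by rw [planePoint_one]; linarith [hN 1]) (by simp) (by simp; omega),
        planePoint_add_two, sub_eq_add_neg]

/-- An intermediate row is swept to the right with memory 0 and back with memory 1; at its left end
the robot steps up and resets the memory. -/
theorem reaches_next_row (hN : ∀ j, 2 ≤ N j) {y : ℤ} (hy : 2 ≤ y) (hyN : y < N 2) {x : ℤ} (hx : x ≤ N 1) :
    Reaches (kdStep N 2) (planePoint x y, false) (planePoint 1 (y + 1), false) := by
  have h1 := hN 1
  refine (reaches_right_of_false hx le_rfl hy).trans ?_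
  refine Reaches.head (kdStep_two_false_turn (by simp) (by simp; omega) (by simpa)) ?_
  rw [planePoint_add_one]
  refine (reaches_left_of_true (x' := 1) le_rfl (by omega) (by omega) hyN).trans ?_
  rw [← planePoint_add_two]
  exact Reaches.of_eq (kdStep_two_true_up (by simp) (by simpa))

theorem reaches_row (hN : ∀ j, 2 ≤ N j) {y y' : ℤ} (hy : 2 ≤ y) (hyy' : y ≤ y') (hy' : y' ≤ N 2) :
    Reaches (kdStep N 2) (planePoint 1 y, false) (planePoint 1 y', false) :=
  Reaches.ascend (F := fun u => (planePoint 1 u, false)) hyy' fun _ _ _ =>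
    reaches_next_row hN (by omega) (by omega) (by linarith [hN 1])

theorem reaches_exit_of_right (hN : ∀ j, 2 ≤ N j) {y : ℤ} (hy : 1 ≤ y) :
    Reaches (kdStep N 2) (planePoint (N 1) y, true) (planePoint 1 (N 2), false) := by
  have h1 := hN 1
  refine (reaches_down_of_true hN le_rfl hy).trans ?_
  refine Reaches.head (kdStep_two_true_corner (by simp; omega) (by simp) (by simp)) ?_
  rw [planePoint_add_one]
  exact (reaches_second_row (by omega)).trans (reaches_row hN le_rfl (hN 2) le_rfl)

theorem reaches_top_right (hN : ∀ j, 2 ≤ N j) {x : ℤ} (hx : x ≤ N 1) :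
    Reaches (kdStep N 2) (planePoint x (N 2), false) (planePoint (N 1) (N 2 - 1), true) := by
  have h2 := hN 2
  refine (reaches_right_of_false hx le_rfl (hN 2)).trans (Reaches.of_eq ?_)
  rw [kdStep_two_false_down (by simp) (by simp; omega) (by simp), planePoint_add_two,
    sub_eq_add_neg]

theorem reaches_plane_exit (hN : ∀ j, 2 ≤ N j) {s : (ℕ → ℤ) × Bool} (hs : s.1 ∈ box N 2) :
    Reaches (kdStep N 2) s (planePoint 1 (N 2), false) := by
  obtain ⟨p, m⟩ := s
  have h1 := hN 1
  have h2 := hN 2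
  obtain ⟨hx, hx'⟩ := box_bounds hs 1 le_rfl (by omega)
  obtain ⟨hy, hy'⟩ := box_bounds hs 2 (by omega) le_rfl
  simp only at hx hx' hy hy' hs
  rw [eq_planePoint hs]
  generalize p 1 = x at *
  generalize p 2 = y at *
  have htop : ∀ x ≤ N 1,
      Reaches (kdStep N 2) (planePoint x (N 2), false) (planePoint 1 (N 2), false) := fun x hx =>
    (reaches_top_right hN hx).trans (reaches_exit_of_right hN (by omega))
  cases m
  · rcases hy.eq_or_lt with rfl | hy1
    · exact (reaches_second_row hx).trans (reaches_row hN le_rfl h2 le_rfl)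
    rcases hy'.eq_or_lt with rfl | hy2
    · exact htop x hx'
    · exact (reaches_next_row hN hy1 hy2 hx').trans (reaches_row hN (by omega) (by omega) le_rfl)
  · rcases hx'.eq_or_lt with rfl | hx2
    · exact reaches_exit_of_right hN hy
    rcases hy'.eq_or_lt with rfl | hy2
    · rcases hx.eq_or_lt with rfl | hx1
      -- This state lies off the closed route; one step moves it into the sweep of the top row.
      · refine Reaches.head (kdStep_two_true_turn (by simp) (by simp)) ?_
        rw [planePoint_add_one]
        exact htop _ h1
      · exact (reaches_right_of_true hx1 hx' le_rfl).trans (reaches_exit_of_right hN hy)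
    · refine (reaches_left_of_true le_rfl hx hx2 hy2).trans ?_
      refine Reaches.head (kdStep_two_true_up (by simp) (by simpa)) ?_
      rw [planePoint_add_two]
      exact reaches_row hN (by omega) (by omega) le_rfl

theorem reaches_right_of_exit (hN : ∀ j, 2 ≤ N j) {y : ℤ} (hy : 1 ≤ y) (hy' : y < N 2) :
    Reaches (kdStep N 2) (planePoint 1 (N 2), false) (planePoint (N 1) y, true) :=
  (reaches_top_right hN (by linarith [hN 1])).trans (reaches_down_of_true hN hy (by omega))

theorem exists_reaches_of_exit (hN : ∀ j, 2 ≤ N j) {p : ℕ → ℤ} (hp : p ∈ box N 2) :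
    ∃ m, Reaches (kdStep N 2) (planePoint 1 (N 2), false) (p, m) := by
  have h1 := hN 1
  have h2 := hN 2
  obtain ⟨hx, hx'⟩ := box_bounds hp 1 le_rfl (by omega)
  obtain ⟨hy, hy'⟩ := box_bounds hp 2 (by omega) le_rfl
  rw [eq_planePoint hp]
  generalize p 1 = x at *
  generalize p 2 = y at *
  have hc := reaches_right_of_exit hN le_rfl (show 1 < N 2 by omega)
  rcases hx'.eq_or_lt with rfl | hx2
  · rcases hy'.eq_or_lt with rfl | hy2
    · exact ⟨false, reaches_right_of_false hx le_rfl h2⟩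
    · exact ⟨true, reaches_right_of_exit hN hy hy2⟩
  · have hl : Reaches (kdStep N 2) (planePoint 1 (N 2), false) (planePoint (N 1 - 1) 1, false) := by
      refine hc.trans (Reaches.of_eq ?_)
      rw [kdStep_two_true_corner (by simp; omega) (by simp) (by simp), planePoint_add_one,
        sub_eq_add_neg]
    rcases hy.eq_or_lt with rfl | hy1
    · exact ⟨false, hl.trans (reaches_left_of_false hx (by omega))⟩
    · exact ⟨false, hl.trans ((reaches_second_row (by omega)).trans
        ((reaches_row hN le_rfl hy1 hy').trans (reaches_right_of_false hx hx' hy1)))⟩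

end Plane

/-! ### From a tower to recurrence one dimension higher, and the tower in dimension 3 -/

section Towers

variable {N : ℕ → ℤ}

/-- Equal states, or states with the same position in `D`. -/
def Twin (D : Set (ℕ → ℤ)) (s s' : (ℕ → ℤ) × Bool) : Prop :=
  s = s' ∨ (s.1 = s'.1 ∧ s.1 ∈ D)

/-- The states at the corner `(N 1, 1, …, 1)` with memory `1` and, in dimension at least `3`, at its
copy in the top plane are reached from every state, and so is every vertex with some memory. -/
structure Recurrent (N : ℕ → ℤ) (k : ℕ) : Prop where
  corner : ∀ s, s.1 ∈ box N k → Reaches (kdStep N k) s (planePoint (N 1) 1, true)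
  exit : ∀ s, s.1 ∈ box N k → Reaches (kdStep N k) s (lift k (N k) (planePoint (N 1) 1, true))
  cover : ∀ p ∈ box N k, ∃ m, ∀ s, s.1 ∈ box N k → Reaches (kdStep N k) s (p, m)

theorem Recurrent.of_tower {k : ℕ} {D : Set (ℕ → ℤ)} {q τ : (ℕ → ℤ) × Bool} (hk : 2 ≤ k)
    (h : Tower (kdStep N k) (kdStep N (k + 1)) {s | s.1 ∈ box N k} (lift (k + 1)) (N (k + 1)) q τ
      {s | s.1 ∈ D ∧ s.2 = true} (Twin D))
    (hD : planePoint (N 1) 1 ∉ D)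
    (hcorner : ∀ s, s.1 ∈ box N k → Reaches (kdStep N k) s (planePoint (N 1) 1, true))
    (hcover : ∀ p ∈ box N k, ∃ m, ∀ s, s.1 ∈ box N k → Reaches (kdStep N k) s (p, m)) :
    Recurrent N (k + 1) where
  corner s hs := by
    obtain ⟨s₀, hs₀, z₀, hz, hz', rfl⟩ := exists_eq_lift hs
    obtain ⟨s', h1, h2⟩ := h.reaches_lift_one (hcorner _ (h.mapsTo _ h.exit_mem))
    -- Twins may differ only at positions in `D`, so outside `D` the shadow of the corner state is
    -- the corner state itself.
    have h3 : s' = (planePoint (N 1) 1, true) := by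
      rcases h1 with h1 | ⟨h1, h1'⟩
      · exact h1
      · exact absurd h1' (by rwa [h1])
    have h4 : lift (k + 1) 1 s' = (planePoint (N 1) 1, true) := by
      rw [h3]
      refine Prod.ext (Function.update_eq_self_iff.2 ?_) rfl
      exact (planePoint_of_three_le _ _ (by omega)).symm
    exact h4 ▸ h2 s₀ hs₀ z₀ hz hz'
  exit s hs := by
    obtain ⟨s₀, hs₀, z₀, hz, hz', rfl⟩ := exists_eq_lift hs
    exact h.reaches_lift hs₀ (hcorner _ (h.mapsTo _ h.exit_mem)) hz hz' h.two_le le_rfl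
  cover p hp := by
    obtain ⟨⟨p₀, m₀⟩, hp₀, z, hz, hz', hpz⟩ := exists_eq_lift (s := (p, true)) hp
    obtain ⟨m, hm⟩ := hcover p₀ hp₀
    have hm := hm _ (h.mapsTo _ h.exit_mem)
    have hpz : Function.update p₀ (k + 1) z = p := congrArg Prod.fst hpz
    rcases hz.eq_or_lt with rfl | hz1
    -- In the bottom plane the memory may be that of a twin, but the position is the required one.
    · obtain ⟨s', h1, h2⟩ := h.reaches_lift_one hm
      have h3 : s'.1 = p₀ := by
        rcases h1 with h1 | ⟨h1, -⟩
        · rw [h1]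
        · exact h1
      refine ⟨s'.2, fun s hs => ?_⟩
      obtain ⟨s₀, hs₀, z₀, hz, hz', rfl⟩ := exists_eq_lift hs
      have := h2 s₀ hs₀ z₀ hz hz'
      rwa [show lift (k + 1) 1 s' = (p, s'.2) by rw [lift, h3, hpz]] at this
    · refine ⟨m, fun s hs => ?_⟩
      obtain ⟨s₀, hs₀, z₀, hz₀, hz₀', rfl⟩ := exists_eq_lift hs
      have := h.reaches_lift hs₀ hm hz₀ hz₀' hz1 hz'
      rwa [show lift (k + 1) z (p₀, m) = (p, m) by rw [lift, hpz]] at this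

/-- The relation is symmetric, so for differing memories one order of the two bits suffices. -/
theorem twin_step {D : Set (ℕ → ℤ)} {f : (ℕ → ℤ) × Bool → (ℕ → ℤ) × Bool} {V : Set (ℕ → ℤ)}
    (h : ∀ p ∈ V, p ∈ D → Twin D (f (p, false)) (f (p, true))) {s s' : (ℕ → ℤ) × Bool}
    (hs : s.1 ∈ V) (hss' : Twin D s s') : Twin D (f s) (f s') := by
  rcases hss' with rfl | ⟨h1, h2⟩
  · exact Or.inl rfl
  · obtain ⟨p, m⟩ := s
    obtain ⟨p', m'⟩ := s'
    obtain rfl : p = p' := h1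
    have := h p hs h2
    cases m <;> cases m'
    · exact Or.inl rfl
    · exact this
    · rcases this with this | ⟨h3, h4⟩
      · exact Or.inl this.symm
      · exact Or.inr ⟨h3.symm, h3 ▸ h4⟩
    · exact Or.inl rfl

theorem lift_add_single_self (j : ℕ) (z a : ℤ) (s : (ℕ → ℤ) × Bool) :
    (lift j z s).1 + Pi.single j a = Function.update s.1 j (z + a) := by
  funext i
  by_cases hi : i = j
  · subst hi; simp [lift]
  · simp [lift, hi]

theorem lift_add_single {i j : ℕ} (hij : i ≠ j) (z a : ℤ) (s : (ℕ → ℤ) × Bool) :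
    (lift j z s).1 + Pi.single i a = Function.update (s.1 + Pi.single i a) j z := by
  funext x
  by_cases hx : x = j
  · subst hx; simp [lift, hij.symm]
  · simp [lift, hx]

theorem lift_apply_self (j : ℕ) (z : ℤ) (s : (ℕ → ℤ) × Bool) : (lift j z s).1 j = z := by
  simp [lift]

theorem lift_apply_of_ne {i j : ℕ} (hij : i ≠ j) (z : ℤ) (s : (ℕ → ℤ) × Bool) :
    (lift j z s).1 i = s.1 i := by
  simp [lift, hij]

/-- The hypothesis is exactly the complement of the two situations in which the procedure for
dimension 3 overrides the planar one. -/
theorem kdStep_three_eq {s : (ℕ → ℤ) × Bool} (h : s.1 2 < N 2 ∨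
    (s.1 1 ≤ 1 ∧ s.2 = true) ∨ (1 < s.1 1 ∧ s.2 = false) ∨ (1 < s.1 1 ∧ s.1 3 ≤ 1)) :
    kdStep N 3 s = kdStep N 2 s := by
  obtain ⟨p, m⟩ := s
  simp only at h
  simp only [kdStep, makeMoveKD, makeMove3D, ne_eq, lowerRoom_eq_zero, upperRoom_eq_zero]
  cases m <;> simp only [eq_self, reduceCtorEq, and_false, and_true, false_or] at h ⊢ <;>
    split_ifs <;> first | rfl | (exfalso; omega)

theorem kdStep_three_up {p : ℕ → ℤ} (h1 : p 1 ≤ 1) (h2 : N 2 ≤ p 2) (h3 : p 3 < N 3) :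
    kdStep N 3 (p, false) = (p + Pi.single 3 1, true) := by
  simp only [kdStep, makeMoveKD, makeMove3D, ne_eq, lowerRoom_eq_zero, upperRoom_eq_zero,
    eq_self, reduceCtorEq, and_false, and_true]
  split_ifs <;> first | rfl | (exfalso; omega)

theorem kdStep_three_top {p : ℕ → ℤ} (h1 : p 1 ≤ 1) (h2 : N 2 ≤ p 2) (h3 : N 3 ≤ p 3) :
    kdStep N 3 (p, false) = (p + Pi.single 1 1, true) := by
  simp only [kdStep, makeMoveKD, makeMove3D, ne_eq, lowerRoom_eq_zero, upperRoom_eq_zero,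
    eq_self, reduceCtorEq, and_false, and_true]
  split_ifs <;> first | rfl | (exfalso; omega)

theorem kdStep_three_down {p : ℕ → ℤ} (h1 : 1 < p 1) (h2 : N 2 ≤ p 2) (h3 : 1 < p 3) :
    kdStep N 3 (p, true) = (p + Pi.single 3 (-1), true) := by
  simp only [kdStep, makeMoveKD, makeMove3D, ne_eq, lowerRoom_eq_zero, upperRoom_eq_zero,
    eq_self, reduceCtorEq, and_false, and_true, if_false]
  split_ifs <;> first | rfl | (exfalso; omega)

/-- The exit is the upper left corner with memory 0. From there the planar tour runs along the top
row with memory 0, so memory 1 on that row beyond the corner is free to signal descent. The twins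
run side by side to the upper right corner, where both step down with memory 1 and merge. -/
theorem tower_three (hN : ∀ j, 2 ≤ N j) :
    Tower (kdStep N 2) (kdStep N 3) {s | s.1 ∈ box N 2} (lift 3) (N 3)
      (planePoint 1 (N 2), false) (planePoint 2 (N 2), true)
      {s | s.1 ∈ {p | 1 < p 1 ∧ p 2 = N 2} ∧ s.2 = true} (Twin {p | 1 < p 1 ∧ p 2 = N 2}) := by
  have h1 := hN 1
  have h2 := hN 2
  have hq : ∀ s : (ℕ → ℤ) × Bool, s.1 ∈ box N 2 → s.1 1 ≤ 1 → N 2 ≤ s.1 2 → s.2 = false →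
      s = (planePoint 1 (N 2), false) := by
    intro s hs hx hy hm
    refine Prod.ext ?_ hm
    have b1 := box_bounds hs 1 le_rfl (by omega)
    have b2 := box_bounds hs 2 (by omega) le_rfl
    rw [eq_planePoint hs, show s.1 1 = 1 by omega, show s.1 2 = N 2 by omega]
  have hqV : planePoint 1 (N 2) ∈ box N 2 :=
    planePoint_mem_box hN le_rfl le_rfl (by omega) (by omega) le_rfl
  have hfq : kdStep N 2 (planePoint 1 (N 2), false) = (planePoint 2 (N 2), false) := by
    rw [kdStep_two_false_right (by simp; omega) (by simp; omega), planePoint_add_one]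
    rfl
  -- The climb arrives with the flipped bit; both bits lead to the same next state, which gives
  -- `up`.
  have hfq' : kdStep N 2 (planePoint 1 (N 2), true) = (planePoint 2 (N 2), false) := by
    rw [kdStep_two_true_turn (by simp) (by simp), planePoint_add_one]
    rfl
  refine
    { two_le := hN 3
      mapsTo := fun s hs => kdStep_mem_box hN (by omega) hs
      exit_mem := hqV
      descent_mem := planePoint_mem_box hN le_rfl (by omega) h1 (by omega) le_rfl
      exit_notMem := by simp
      descent_start := by simp
      transient := ?_
      inside := ?_
      down := ?_
      up := ?_
      top := ?_
      shadow_start := ?_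
      shadow_step := fun s hs s' => twin_step (V := box N 2) ?_ hs
      shadow_exit := ?_
      exit_reached := fun s hs => reaches_plane_exit hN hs }
  · rintro ⟨p, m⟩ hs hT ⟨⟨hx, hy⟩, hm⟩
    have b1 := box_bounds hs 1 le_rfl (by omega)
    have b2 := box_bounds hs 2 (by omega) le_rfl
    revert hx hy hm hT
    simp only [kdStep, makeMoveKD, makeMove2D, ne_eq, mul_eq_zero, lowerRoom_eq_zero,
      upperRoom_eq_zero, Set.mem_ofPred_eq]
    simp only at b1 b2
    cases m <;> simp only [Bool.true_eq_false, if_true, if_false] <;> split_ifs <;> simp <;> omega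
  · intro s hs z hz hzn hsq hT
    rw [kdStep_three_eq, kdStep_lift hN (by omega) hs (by omega)]
    rw [lift_apply_of_ne (by omega), lift_apply_of_ne (by omega), lift_apply_self]
    have b2 := (box_bounds hs 2 (by omega) le_rfl).2
    rcases b2.lt_or_eq with h | h
    · exact Or.inl h
    cases hm : s.2
    · refine Or.inr (Or.inr (Or.inl ⟨?_, hm⟩))
      by_contra hx
      exact hsq (hq s hs (by omega) h.ge hm)
    · by_cases hx : s.1 1 ≤ 1
      · exact Or.inr (Or.inl ⟨hx, hm⟩)
      · exact Or.inr (Or.inr (Or.inr ⟨by omega, (hT ⟨⟨by omega, h⟩, hm⟩).le⟩))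
  · rintro ⟨p, m⟩ hs ⟨⟨hx, hy⟩, rfl⟩ z hz hzn
    have h3 : kdStep N 3 (lift 3 z (p, true)) = ((lift 3 z (p, true)).1 + Pi.single 3 (-1), true) :=
      kdStep_three_down hx hy.ge (by rw [Function.update_self]; exact hz)
    rw [h3, lift_add_single_self, ← sub_eq_add_neg]
    rfl
  · intro z hz hzn
    have h3 : kdStep N 3 (lift 3 z (planePoint 1 (N 2), false)) =
        ((lift 3 z (planePoint 1 (N 2), false)).1 + Pi.single 3 1, true) :=
      kdStep_three_up le_rfl le_rfl (by rw [Function.update_self]; exact hzn)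
    rw [h3, lift_add_single_self]
    change kdStep N 3 (lift 3 (z + 1) (planePoint 1 (N 2), true)) = _
    rw [kdStep_three_eq (Or.inr (Or.inl ⟨le_rfl, rfl⟩)),
      kdStep_lift hN (by omega) hqV (by omega), hfq, hfq']
  · have h3 : kdStep N 3 (lift 3 (N 3) (planePoint 1 (N 2), false)) =
        ((lift 3 (N 3) (planePoint 1 (N 2), false)).1 + Pi.single 1 1, true) :=
      kdStep_three_top le_rfl le_rfl (by rw [Function.update_self])
    rw [h3, lift_add_single (by omega), planePoint_add_one]
    rfl
  · rw [hfq]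
    exact Or.inr ⟨rfl, by simp⟩
  · rintro p hp ⟨hx, hy⟩
    by_cases hxN : p 1 < N 1
    · rw [kdStep_two_false_right hxN (by omega), kdStep_two_true_right hx hxN hy.ge]
      exact Or.inr ⟨rfl, by simp; omega⟩
    · rw [kdStep_two_false_down (by omega) (by omega) hy.ge,
        kdStep_two_true_down hx (by omega) (by omega)]
      exact Or.inl rfl
  · rintro s' (h | ⟨h, h'⟩)
    · exact h.symm
    · simp at h'

theorem recurrent_three (hN : ∀ j, 2 ≤ N j) : Recurrent N 3 := by
  have h2 := hN 2
  refine Recurrent.of_tower le_rfl (tower_three hN) (by simp; omega) (fun s hs => ?_)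
    fun p hp => ?_
  · exact (reaches_plane_exit hN hs).trans (reaches_right_of_exit hN le_rfl (by omega))
  · obtain ⟨m, hm⟩ := exists_reaches_of_exit hN hp
    exact ⟨m, fun s hs => (reaches_plane_exit hN hs).trans hm⟩

end Towers

/-! ### Towers in dimension at least 4 -/

section HigherTowers

variable {N : ℕ → ℤ}

theorem kdStep_succ_eq {k : ℕ} {s : (ℕ → ℤ) × Bool}
    (h : (∀ j, 2 ≤ j → j ≤ k + 2 → s.1 j ≤ 1) → N (k + 3) ≤ s.1 (k + 3) → s.2 = true →
      s.1 1 < N 1 ∧ s.1 (k + 4) ≤ 1) : kdStep N (k + 4) s = kdStep N (k + 3) s := by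
  obtain ⟨p, m⟩ := s
  simp only at h
  simp only [kdStep, makeMoveKD, makeMoveSucc, ne_eq, lowerRoom_eq_zero, upperRoom_eq_zero]
  split_ifs with h1 h2 h3 h4
  iterate 2
    have := h (fun j hj hj' => h1.1 j (Finset.mem_Icc.2 ⟨hj, by omega⟩)) h1.2.1 h1.2.2
    exact absurd this.1 (by omega)
  · rfl
  · have := h (fun j hj hj' => h1.1 j (Finset.mem_Icc.2 ⟨hj, by omega⟩)) h1.2.1 h1.2.2
    exact absurd this.2 (by assumption)
  · rfl

theorem kdStep_succ_special {k : ℕ} {p : ℕ → ℤ}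
    (h : ∀ j, 2 ≤ j → j ≤ k + 2 → p j ≤ 1) (hk : N (k + 3) ≤ p (k + 3)) :
    kdStep N (k + 4) (p, true) =
      if N 1 ≤ p 1 then
        if N (k + 4) ≤ p (k + 4) then (p + Pi.single 1 (-1), true)
        else (p + Pi.single (k + 4) 1, false)
      else if 1 < p (k + 4) then (p + Pi.single (k + 4) (-1), true)
      else kdStep N (k + 3) (p, true) := by
  have hc : (∀ j ∈ Finset.Icc 2 (k + 3 - 1), p j ≤ 1) ∧ N (k + 3) ≤ p (k + 3) :=
    ⟨fun j hj => h j (Finset.mem_Icc.1 hj).1 (by have := (Finset.mem_Icc.1 hj).2; omega), hk⟩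
  simp only [kdStep, makeMoveKD, makeMoveSucc, ne_eq, lowerRoom_eq_zero, upperRoom_eq_zero,
    eq_self, and_true, if_pos hc, not_le]
  split_ifs <;> rfl

/-- On the edge of the plane that leads to its exit, the procedure acts as in dimension `2`. -/
theorem kdStep_edge (hN : ∀ j, 2 ≤ N j) {k : ℕ} {s : (ℕ → ℤ) × Bool}
    (h : ∀ j, 2 ≤ j → j ≤ k + 2 → s.1 j = 1) : kdStep N (k + 3) s = kdStep N 2 s :=
  kdStep_eq_two N (k + 1) s fun j h1 h2 => by
    have := hN j
    rw [h j h1 (by omega)]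
    omega

/-- The exit `c` is the copy of the corner in the upper face of axis k + 3, and `D` is the rest of
the edge through `c` parallel to axis 1. The tour leaves `c` along this edge with memory 0, so
memory 1 there can signal descent. The twins walk left together and merge at its far end, where both
step up along axis 2 with memory 0. -/
theorem tower_succ (hN : ∀ j, 2 ≤ N j) {k : ℕ} {c : ℕ → ℤ}
    (hc : c = (lift (k + 3) (N (k + 3)) (planePoint (N 1) 1, true)).1) {D : Set (ℕ → ℤ)}
    (hD : D = {p | p 1 < N 1 ∧ (∀ j, 2 ≤ j → j ≤ k + 2 → p j = 1) ∧ p (k + 3) = N (k + 3)})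
    (hexit : ∀ s, s.1 ∈ box N (k + 3) → Reaches (kdStep N (k + 3)) s (c, true)) :
    Tower (kdStep N (k + 3)) (kdStep N (k + 4)) {s | s.1 ∈ box N (k + 3)} (lift (k + 4))
      (N (k + 4)) (c, true) (c + Pi.single 1 (-1), true) {s | s.1 ∈ D ∧ s.2 = true} (Twin D) := by
  have h1 := hN 1
  have h2 := hN 2
  have h3 := hN (k + 3)
  have c1 : c 1 = N 1 := by rw [hc, lift_apply_of_ne (by omega)]; rfl
  have cj : ∀ j, 2 ≤ j → j ≤ k + 2 → c j = 1 := by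
    intro j hj hj'
    rw [hc, lift_apply_of_ne (by omega)]
    change planePoint (N 1) 1 j = 1
    unfold planePoint
    split_ifs <;> omega
  have ck : c (k + 3) = N (k + 3) := by rw [hc, lift_apply_self]
  have hcV : c ∈ box N (k + 3) := by
    rw [hc]
    exact lift_mem_box (k := k + 2) (planePoint_mem_box hN (by omega) (by omega) le_rfl le_rfl
      (by omega)) (by omega) le_rfl
  have hq : ∀ s : (ℕ → ℤ) × Bool, s.1 ∈ box N (k + 3) → N 1 ≤ s.1 1 →
      (∀ j, 2 ≤ j → j ≤ k + 2 → s.1 j ≤ 1) → N (k + 3) ≤ s.1 (k + 3) → s.2 = true →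
      s = (c, true) := by
    intro s hs hx hy hz hm
    refine Prod.ext (funext fun j => ?_) hm
    by_cases hj : 1 ≤ j ∧ j ≤ k + 3
    · have b := box_bounds hs j hj.1 hj.2
      rcases (by omega : j = 1 ∨ (2 ≤ j ∧ j ≤ k + 2) ∨ j = k + 3) with rfl | hj | rfl
      · exact (le_antisymm b.2 hx).trans c1.symm
      · exact (le_antisymm (hy j hj.1 hj.2) b.1).trans (cj j hj.1 hj.2).symm
      · exact (le_antisymm b.2 hz).trans ck.symm
    · exact (box_eq_one hs hj).trans (box_eq_one hcV hj).symm
  -- Independence of `m` absorbs the memory flip made when climbing.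
  have hfq : ∀ m, kdStep N (k + 3) (c, m) = (c + Pi.single 1 (-1), false) := by
    intro m
    have c2 := cj 2 le_rfl (by omega)
    rw [kdStep_edge hN cj]
    cases m
    · exact kdStep_two_false_left (by omega) (by omega)
    · exact kdStep_two_true_corner (by omega) (by omega) (by omega)
  have hτD : c + Pi.single 1 (-1) ∈ D := by
    rw [hD]
    refine ⟨?_, fun j hj hj' => ?_, ?_⟩
    · simp [c1]
    · rw [Pi.add_apply, Pi.single_eq_of_ne (by omega), add_zero, cj j hj hj']
    · rw [Pi.add_apply, Pi.single_eq_of_ne (by omega), add_zero, ck]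
  have hτV : c + Pi.single 1 (-1) ∈ box N (k + 3) := by
    have := kdStep_mem_box hN (by omega) (s := (c, true)) hcV
    rwa [hfq] at this
  have hcD : c ∉ D := by
    rw [hD]
    rintro ⟨h, -⟩
    omega
  refine
    { two_le := hN (k + 4)
      mapsTo := fun s hs => kdStep_mem_box hN (by omega) hs
      exit_mem := hcV
      descent_mem := hτV
      exit_notMem := fun h => hcD h.1
      descent_start := ⟨hτD, rfl⟩
      transient := ?_
      inside := ?_
      down := ?_
      up := ?_
      top := ?_
      shadow_start := ?_
      shadow_step := fun s hs s' => twin_step (V := box N (k + 3)) ?_ hs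
      shadow_exit := ?_
      exit_reached := hexit }
  · rintro ⟨p, m⟩ hs hT ⟨hTD, hm⟩
    rw [hD] at hTD
    obtain ⟨hx, hy, hz⟩ := hTD
    -- The endpoint lies on the edge, away from the upper faces of the axes 2, …, k + 2, so the step
    -- was planar.
    have he : kdStep N (k + 3) (p, m) = kdStep N 2 (p, m) :=
      kdStep_eq_two_of_image N (k + 1) _ fun j hj hj' => by
        have := hN j
        have := hy j hj (by omega)
        change (kdStep N (k + 3) (p, m)).1 j < _
        omega
    rw [he] at hx hy hz hm
    have hy2 := hy 2 le_rfl (by omega)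
    -- A planar step that ends in the bottom row, left of the right column, with memory 1 can only
    -- be a step to the left that already had memory 1.
    have key : m = true ∧ kdStep N 2 (p, m) = (p + Pi.single 1 (-1), true) ∧ p 1 < N 1 := by
      have b1 := box_bounds hs 1 le_rfl (by omega)
      have b2 := box_bounds hs 2 (by omega) (by omega)
      clear hy hT hz he
      revert hx hy2 hm
      simp only [kdStep, makeMoveKD, makeMove2D, ne_eq, mul_eq_zero, lowerRoom_eq_zero,
        upperRoom_eq_zero]
      simp only at b1 b2
      cases m <;> simp only [eq_self, reduceCtorEq, if_true, if_false] <;> split_ifs <;> simp <;>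
        omega
    obtain ⟨rfl, hstep, hp1⟩ := key
    rw [hstep] at hy hz
    refine hT ⟨hD ▸ ⟨hp1, fun j hj hj' => ?_, ?_⟩, rfl⟩
    · simpa [Pi.single_eq_of_ne (show j ≠ 1 by omega)] using hy j hj hj'
    · simpa using hz
  · intro s hs z hz hzn hsq hT
    rw [kdStep_succ_eq, kdStep_lift hN (by omega) hs (by omega)]
    rw [lift_apply_of_ne (by omega), lift_apply_of_ne (by omega), lift_apply_self]
    intro hy hyz hm
    have hy : ∀ j, 2 ≤ j → j ≤ k + 2 → s.1 j ≤ 1 := fun j hj hj' => by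
      have := hy j hj hj'
      rwa [lift_apply_of_ne (by omega)] at this
    have hx : s.1 1 < N 1 := by
      by_contra hx
      exact hsq (hq s hs (by omega) hy hyz hm)
    refine ⟨hx, (hT ⟨hD ▸ ⟨hx, fun j hj hj' => ?_, ?_⟩, hm⟩).le⟩
    · exact le_antisymm (hy j hj hj') (box_bounds hs j (by omega) (by omega)).1
    · exact le_antisymm (box_bounds hs (k + 3) (by omega) le_rfl).2 hyz
  · rintro ⟨p, m⟩ hs ⟨hTD, rfl⟩ z hz hzn
    rw [hD] at hTD
    obtain ⟨hx, hy, hyz⟩ := hTD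
    have hstep := kdStep_succ_special (N := N) (k := k) (p := (lift (k + 4) z (p, true)).1)
      (fun j hj hj' => by rw [lift_apply_of_ne (by omega)]; exact (hy j hj hj').le)
      (by rw [lift_apply_of_ne (by omega)]; exact hyz.ge)
    rw [lift_apply_of_ne (by omega), lift_apply_self, if_neg (not_le.2 hx), if_pos hz,
      lift_add_single_self, ← sub_eq_add_neg] at hstep
    exact hstep
  · intro z hz hzn
    have hstep := kdStep_succ_special (N := N) (k := k) (p := (lift (k + 4) z (c, true)).1)
      (fun j hj hj' => by rw [lift_apply_of_ne (by omega)]; exact (cj j hj hj').le)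
      (by rw [lift_apply_of_ne (by omega)]; exact ck.ge)
    rw [lift_apply_of_ne (by omega), lift_apply_self, if_pos c1.ge, if_neg (not_le.2 hzn),
      lift_add_single_self] at hstep
    have hstep : kdStep N (k + 4) (lift (k + 4) z (c, true)) = lift (k + 4) (z + 1) (c, false) :=
      hstep
    rw [hstep, kdStep_succ_eq (fun _ _ h => absurd h Bool.false_ne_true),
      kdStep_lift hN (by omega) hcV (by omega), hfq, hfq]
  · have hstep := kdStep_succ_special (N := N) (k := k)
      (p := (lift (k + 4) (N (k + 4)) (c, true)).1)
      (fun j hj hj' => by rw [lift_apply_of_ne (by omega)]; exact (cj j hj hj').le)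
      (by rw [lift_apply_of_ne (by omega)]; exact ck.ge)
    rw [lift_apply_of_ne (by omega), lift_apply_self, if_pos c1.ge, if_pos le_rfl,
      lift_add_single (by omega)] at hstep
    exact hstep
  · rw [hfq]
    exact Or.inr ⟨rfl, hτD⟩
  · intro p hp hpD
    have hpD' := hpD
    rw [hD] at hpD'
    obtain ⟨hx, hy, hz⟩ := hpD'
    have hy2 := hy 2 le_rfl (by omega)
    rw [kdStep_edge hN hy, kdStep_edge hN hy]
    by_cases hx1 : 1 < p 1
    · rw [kdStep_two_false_left hx1 (by omega), kdStep_two_true_left hx1 hx (by omega)]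
      refine Or.inr ⟨rfl, hD ▸ ⟨?_, fun j hj hj' => ?_, ?_⟩⟩
      · simp
        omega
      · simpa [Pi.single_eq_of_ne (show j ≠ 1 by omega)] using hy j hj hj'
      · simpa using hz
    · rw [kdStep_two_false_up (by omega) (by omega), kdStep_two_true_up (by omega) (by omega)]
      exact Or.inl rfl
  · rintro s' (h | ⟨h, h'⟩)
    · exact h.symm
    · exact absurd h' hcD

theorem recurrent_of_three_le (hN : ∀ j, 2 ≤ N j) (k : ℕ) : Recurrent N (k + 3) := by
  induction k with
  | zero => exact recurrent_three hN
  | succ k ih =>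
    refine Recurrent.of_tower (by omega) (tower_succ hN rfl rfl ih.exit) ?_ ih.corner ih.cover
    rintro ⟨h, -⟩
    simp at h

end HigherTowers

/-! ### Dimension 1 -/

section Line

variable {N : ℕ → ℤ}

theorem eq_planePoint_of_line {p : ℕ → ℤ} (hp : p ∈ box N 1) : p = planePoint (p 1) 1 := by
  funext j
  unfold planePoint
  split_ifs with h1 h2
  · rw [h1]
  · rw [box_eq_one hp (by omega)]
  · exact box_eq_one hp (by omega)

theorem kdStep_one_false_right {x : ℤ} (hx : x < N 1) :
    kdStep N 1 (planePoint x 1, false) = (planePoint (x + 1) 1, false) := by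
  simp [kdStep, makeMoveKD, makeMove1D, upperRoom_eq_zero, hx, planePoint_add_one]

theorem kdStep_one_false_turn :
    kdStep N 1 (planePoint (N 1) 1, false) = (planePoint (N 1 - 1) 1, true) := by
  simp [kdStep, makeMoveKD, makeMove1D, upperRoom_eq_zero, planePoint_add_one, sub_eq_add_neg]

theorem kdStep_one_true_left {x : ℤ} (hx : 1 < x) :
    kdStep N 1 (planePoint x 1, true) = (planePoint (x - 1) 1, true) := by
  simp [kdStep, makeMoveKD, makeMove1D, lowerRoom_eq_zero, hx, planePoint_add_one, sub_eq_add_neg]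

theorem kdStep_one_true_turn :
    kdStep N 1 (planePoint 1 1, true) = (planePoint 2 1, false) := by
  simp [kdStep, makeMoveKD, makeMove1D, lowerRoom_eq_zero, planePoint_add_one]

theorem exists_reaches_line (hN : ∀ j, 2 ≤ N j) {s : (ℕ → ℤ) × Bool} (hs : s.1 ∈ box N 1)
    {p : ℕ → ℤ} (hp : p ∈ box N 1) : ∃ m, Reaches (kdStep N 1) s (p, m) := by
  have h1 := hN 1
  have hb := box_bounds hp 1 le_rfl le_rfl
  have hb' := box_bounds hs 1 le_rfl le_rfl
  obtain ⟨p', m⟩ := s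
  simp only at hb' hs
  rw [eq_planePoint_of_line hp, eq_planePoint_of_line hs]
  generalize p 1 = x at *
  generalize p' 1 = y at *
  have hright : ∀ y ≤ N 1,
      Reaches (kdStep N 1) (planePoint y 1, false) (planePoint (N 1) 1, false) := fun y hy =>
    Reaches.ascend (F := fun u => (planePoint u 1, false)) hy fun u _ h2 =>
      Reaches.of_eq (kdStep_one_false_right h2)
  have hleft : ∀ y y', 1 ≤ y' → y' ≤ y →
      Reaches (kdStep N 1) (planePoint y 1, true) (planePoint y' 1, true) := fun y y' hy' hyy' =>
    Reaches.descend (F := fun u => (planePoint u 1, true)) hyy' fun u h1 _ =>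
      Reaches.of_eq (kdStep_one_true_left (by omega))
  have hend : Reaches (kdStep N 1) (planePoint y 1, m) (planePoint (N 1) 1, false) := by
    cases m
    · exact hright y hb'.2
    · exact (hleft y 1 le_rfl hb'.1).trans (Reaches.head kdStep_one_true_turn (hright 2 h1))
  rcases hb.2.eq_or_lt with rfl | hx
  · exact ⟨false, hend⟩
  · exact ⟨true, hend.trans (Reaches.head kdStep_one_false_turn
      (hleft _ _ hb.1 (by omega)))⟩

end Line

/-- Every vertex is eventually visited, from every state. -/
theorem exists_reaches {N : ℕ → ℤ} (hN : ∀ j, 2 ≤ N j) {k : ℕ} (hk : 1 ≤ k)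
    {s : (ℕ → ℤ) × Bool} (hs : s.1 ∈ box N k) {p : ℕ → ℤ} (hp : p ∈ box N k) :
    ∃ m, Reaches (kdStep N k) s (p, m) := by
  match k, hk with
  | 1, _ => exact exists_reaches_line hN hs hp
  | 2, _ =>
    obtain ⟨m, hm⟩ := exists_reaches_of_exit hN hp
    exact ⟨m, (reaches_plane_exit hN hs).trans hm⟩
  | k + 3, _ =>
    obtain ⟨m, hm⟩ := (recurrent_of_three_le hN k).cover p hp
    exact ⟨m, hm s hs⟩

/-! ### From sensing data to the procedure on integer sequences -/

section Sensing

variable {d : ℕ} {n : Fin d → ℕ} {p : Fin d → ℤ}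

theorem mem_gridVertices : p ∈ gridVertices n ↔ ∀ i, 1 ≤ p i ∧ p i ≤ n i := by
  simp [gridVertices, Fintype.mem_piFinset]

/-- A vector on axis i has Manhattan norm equal to the absolute value of its one entry, so range 1
leaves only 0 and the two unit vectors. -/
theorem mem_projection_sense_iff (i : Fin d) (u : Fin d → ℤ) :
    u ∈ projection (sense n 1 p) i ↔
      p + u ∈ gridVertices n ∧ ∃ a : ℤ, a.natAbs ≤ 1 ∧ u = Pi.single i a := by
  have hsum : ∀ a : ℤ, manhattanDist p (p + Pi.single i a) = a.natAbs := by
    intro a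
    unfold manhattanDist
    rw [Finset.sum_eq_single i (fun j _ hj => by simp [Pi.single_eq_of_ne hj]) (by simp)]
    simp
  constructor
  · rintro ⟨⟨q, hq, hd, rfl⟩, hu⟩
    have hs : q - p = Pi.single i ((q - p) i) := by
      funext j
      by_cases hj : j = i
      · subst hj; simp
      · rw [Pi.single_eq_of_ne hj, hu j hj]
    refine ⟨by rwa [add_sub_cancel], (q - p) i, ?_, hs⟩
    rw [← hsum, ← hs, add_sub_cancel]
    exact hd
  · rintro ⟨hq, a, ha, rfl⟩
    exact ⟨⟨_, hq, (hsum a).trans_le ha, by simp⟩, fun j hj => by simp [Pi.single_eq_of_ne hj]⟩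

theorem add_single_mem_gridVertices_iff (hp : p ∈ gridVertices n) (i : Fin d) (a : ℤ) :
    p + Pi.single i a ∈ gridVertices n ↔ 1 ≤ p i + a ∧ p i + a ≤ n i := by
  rw [mem_gridVertices] at hp ⊢
  refine ⟨fun h => by simpa using h i, fun h j => ?_⟩
  by_cases hj : j = i
  · subst hj; simpa using h
  · simpa [Pi.single_eq_of_ne hj] using hp j

theorem lowerDist_sense (hp : p ∈ gridVertices n) (i : Fin d) :
    lowerDist (sense n 1 p) i = if 1 < p i then 1 else 0 := by
  have hb := mem_gridVertices.1 hp i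
  have hset : {u ∈ projection (sense n 1 p) i | u i < 0} =
      if 1 < p i then {Pi.single i (-1)} else ∅ := by
    ext u
    simp only [mem_projection_sense_iff, Set.mem_ofPred_eq]
    constructor
    · rintro ⟨⟨h1, a, ha, rfl⟩, h2⟩
      rw [Pi.single_eq_same] at h2
      obtain rfl : a = -1 := by omega
      have := (add_single_mem_gridVertices_iff hp i _).1 h1
      rw [if_pos (by omega)]
      rfl
    · split_ifs with h
      · rintro rfl
        exact ⟨⟨(add_single_mem_gridVertices_iff hp i _).2 (by omega), -1, by simp, rfl⟩,
          by simp⟩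
      · exact fun h => h.elim
  rw [lowerDist, hset]
  split_ifs <;> simp

theorem upperDist_sense (hp : p ∈ gridVertices n) (i : Fin d) :
    upperDist (sense n 1 p) i = if p i < n i then 1 else 0 := by
  have hb := mem_gridVertices.1 hp i
  have hset : {u ∈ projection (sense n 1 p) i | 0 < u i} =
      if p i < n i then {Pi.single i 1} else ∅ := by
    ext u
    simp only [mem_projection_sense_iff, Set.mem_ofPred_eq]
    constructor
    · rintro ⟨⟨h1, a, ha, rfl⟩, h2⟩
      rw [Pi.single_eq_same] at h2
      obtain rfl : a = 1 := by omega
      have := (add_single_mem_gridVertices_iff hp i _).1 h1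
      rw [if_pos (by omega)]
      rfl
    · split_ifs with h
      · rintro rfl
        exact ⟨⟨(add_single_mem_gridVertices_iff hp i _).2 (by omega), 1, by simp, rfl⟩,
          by simp⟩
      · exact fun h => h.elim
  rw [upperDist, hset]
  split_ifs <;> simp

/-- The side lengths numbered from `1`; the sides with other numbers are never read. -/
def sides (n : Fin d → ℕ) (j : ℕ) : ℤ := if h : 1 ≤ j ∧ j ≤ d then n ⟨j - 1, by omega⟩ else 2

/-- The coordinates numbered from `1`, extended by `1`. -/
def extend (p : Fin d → ℤ) (j : ℕ) : ℤ := if h : 1 ≤ j ∧ j ≤ d then p ⟨j - 1, by omega⟩ else 1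

theorem extend_succ (p : Fin d → ℤ) (i : Fin d) : extend p (i + 1) = p i := by
  simp [extend]

theorem extend_injective : Function.Injective (extend : (Fin d → ℤ) → ℕ → ℤ) := by
  intro p q h
  funext i
  rw [← extend_succ p, ← extend_succ q, h]

/-- The default value 2 is what makes the bound hold for every index, as the lemmas on `kdStep`
require. -/
theorem two_le_sides (hn : ∀ i, 1 < n i) (j : ℕ) : 2 ≤ sides n j := by
  unfold sides
  split_ifs
  · exact_mod_cast hn _
  · exact le_rfl

theorem extend_mem_box_iff : extend p ∈ box (sides n) d ↔ p ∈ gridVertices n := by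
  rw [mem_gridVertices]
  constructor
  · intro h i
    have := box_bounds h (i + 1) (by omega) (by omega)
    simpa [extend, sides] using this
  · intro h j
    unfold extend sides
    split_ifs
    · exact h _
    · simp

/-- States of the robot with coordinates numbered from `1`. -/
def extendState (s : (Fin d → ℤ) × Memory 1) : (ℕ → ℤ) × Bool := (extend s.1, s.2 0)

theorem makeMove_sense (hp : p ∈ gridVertices n) (m : Memory 1) :
    makeMove d (sense n 1 p) m =
      (fun i => (makeMoveKD d (lowerRoom (extend p)) (upperRoom (sides n) (extend p)) (m 0)).1
        (i.val + 1),
      fun _ => (makeMoveKD d (lowerRoom (extend p)) (upperRoom (sides n) (extend p)) (m 0)).2) := by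
  have hc : makeMoveKD d (oneBased (lowerDist (sense n 1 p))) (oneBased (upperDist (sense n 1 p)))
      (m 0) = makeMoveKD d (lowerRoom (extend p)) (upperRoom (sides n) (extend p)) (m 0) := by
    refine makeMoveKD_congr d _ (fun j h1 h2 => ?_) fun j h1 h2 => ?_
    · rw [oneBased, dif_pos ⟨h1, h2⟩, lowerDist_sense hp, lowerRoom, extend, dif_pos ⟨h1, h2⟩]
    · rw [oneBased, dif_pos ⟨h1, h2⟩, upperDist_sense hp, upperRoom, extend, dif_pos ⟨h1, h2⟩,
        sides, dif_pos ⟨h1, h2⟩]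
  unfold makeMove
  rw [hc]

theorem exists_makeMove_sense (hd : 1 ≤ d) (hn : ∀ i, 1 < n i) (hp : p ∈ gridVertices n)
    (m : Memory 1) : ∃ i, ∃ e : ℤ, (e = 1 ∨ e = -1) ∧ p + Pi.single i e ∈ gridVertices n ∧
      (makeMove d (sense n 1 p) m).1 = Pi.single i e ∧
      (makeMoveKD d (lowerRoom (extend p)) (upperRoom (sides n) (extend p)) (m 0)).1 =
        Pi.single (i.val + 1) e := by
  obtain ⟨j, hj1, hj2, e, he, h1, h2, h3⟩ := makeMoveKD_valid (two_le_sides hn) hd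
    (box_bounds (extend_mem_box_iff.2 hp)) (m 0)
  obtain ⟨i, rfl⟩ : ∃ i : Fin d, j = i.val + 1 := ⟨⟨j - 1, by omega⟩, by simp; omega⟩
  rw [extend_succ] at h1 h2
  refine ⟨i, e, he, (add_single_mem_gridVertices_iff hp i e).2 ⟨h1, ?_⟩, ?_, h3⟩
  · simpa [sides] using h2
  · rw [makeMove_sense hp, h3]
    funext x
    by_cases hx : x = i
    · subst hx; simp
    · rw [Pi.single_eq_of_ne hx]
      change (Pi.single (i.val + 1) e : ℕ → ℤ) (x.val + 1) = 0
      rw [Pi.single_eq_of_ne]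
      exact fun h => hx (Fin.ext (by omega))

theorem step_mem_gridVertices (hd : 1 ≤ d) (hn : ∀ i, 1 < n i) {s : (Fin d → ℤ) × Memory 1}
    (hs : s.1 ∈ gridVertices n) : (step n 1 (makeMove d) s).1 ∈ gridVertices n := by
  obtain ⟨i, e, -, h, h', -⟩ := exists_makeMove_sense hd hn hs s.2
  rw [step, h']
  exact h

theorem manhattanDist_step (hd : 1 ≤ d) (hn : ∀ i, 1 < n i) {s : (Fin d → ℤ) × Memory 1}
    (hs : s.1 ∈ gridVertices n) : manhattanDist s.1 (step n 1 (makeMove d) s).1 = 1 := by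
  obtain ⟨i, e, he, -, h', -⟩ := exists_makeMove_sense hd hn hs s.2
  rw [step, h', manhattanDist,
    Finset.sum_eq_single i (fun j _ hj => by simp [Pi.single_eq_of_ne hj]) (by simp)]
  rcases he with rfl | rfl <;> simp

/-- `extendState` intertwines the robot with `kdStep`, so reachability proved for sequences carries
over to it. -/
theorem extendState_step (hd : 1 ≤ d) (hn : ∀ i, 1 < n i) {s : (Fin d → ℤ) × Memory 1}
    (hs : s.1 ∈ gridVertices n) :
    extendState (step n 1 (makeMove d) s) = kdStep (sides n) d (extendState s) := by
  obtain ⟨i, e, -, -, h1, h2⟩ := exists_makeMove_sense hd hn hs s.2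
  refine Prod.ext ?_ ?_
  · simp only [extendState, step, kdStep, h1, h2]
    funext j
    by_cases hj : 1 ≤ j ∧ j ≤ d
    · obtain ⟨x, rfl⟩ : ∃ x : Fin d, j = x.val + 1 := ⟨⟨j - 1, by omega⟩, by simp; omega⟩
      rw [Pi.add_apply, extend_succ, extend_succ, Pi.add_apply]
      by_cases hx : x = i
      · subst hx; simp
      · rw [Pi.single_eq_of_ne hx, Pi.single_eq_of_ne]
        intro h
        exact hx (Fin.ext (by omega))
    · rw [Pi.add_apply, extend, extend, dif_neg hj, dif_neg hj, Pi.single_eq_of_ne, add_zero]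
      rintro rfl
      exact hj ⟨by omega, by omega⟩
  · simp only [extendState, step, kdStep, makeMove_sense hs]

theorem iterate_step_mem_gridVertices (hd : 1 ≤ d) (hn : ∀ i, 1 < n i)
    {s : (Fin d → ℤ) × Memory 1} (hs : s.1 ∈ gridVertices n) (t : ℕ) :
    ((step n 1 (makeMove d))^[t] s).1 ∈ gridVertices n :=
  mapsTo_iterate (V := {s : (Fin d → ℤ) × Memory 1 | s.1 ∈ gridVertices n})
    (fun _ hs => step_mem_gridVertices hd hn hs) hs t

theorem extendState_iterate_step (hd : 1 ≤ d) (hn : ∀ i, 1 < n i)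
    {s : (Fin d → ℤ) × Memory 1} (hs : s.1 ∈ gridVertices n) (t : ℕ) :
    extendState ((step n 1 (makeMove d))^[t] s) = (kdStep (sides n) d)^[t] (extendState s) := by
  induction t with
  | zero => rfl
  | succ t ih =>
    rw [Function.iterate_succ_apply', Function.iterate_succ_apply', ← ih,
      extendState_step hd hn (iterate_step_mem_gridVertices hd hn hs t)]

theorem exists_position_eq (hd : 1 ≤ d) (hn : ∀ i, 1 < n i) {v₁ v : Fin d → ℤ}
    (hv₁ : v₁ ∈ gridVertices n) (hv : v ∈ gridVertices n) (m : Memory 1) :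
    ∃ t < 2 * (gridVertices n).card, position n 1 (makeMove d) v₁ m t = v := by
  classical
  obtain ⟨m', t, ht⟩ := exists_reaches (two_le_sides hn) hd (s := extendState (v₁, m))
    (extend_mem_box_iff.2 hv₁) (extend_mem_box_iff.2 hv)
  rw [← extendState_iterate_step hd hn hv₁] at ht
  -- The final memory is irrelevant; the position is recovered by injectivity of `extend`.
  have ht : ((step n 1 (makeMove d))^[t] (v₁, m)).1 = v := extend_injective (congrArg Prod.fst ht)
  obtain ⟨t', ht', he⟩ := Reaches.exists_lt_card (f := step n 1 (makeMove d))
    (A := gridVertices n ×ˢ (Finset.univ : Finset (Memory 1)))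
    (fun s hs => Finset.mem_product.2
      ⟨step_mem_gridVertices hd hn (Finset.mem_product.1 hs).1, Finset.mem_univ _⟩)
    (s := (v₁, m)) (Finset.mem_product.2 ⟨hv₁, Finset.mem_univ _⟩) ⟨t, rfl⟩
  refine ⟨t', ?_, by rw [position, he, ht]⟩
  have hcard : (gridVertices n ×ˢ (Finset.univ : Finset (Memory 1))).card =
      2 * (gridVertices n).card := by
    simp [Finset.card_product, mul_comm]
  omega

end Sensing
end GridPatrol

theorem theorem2 (d : ℕ) (hd : 1 ≤ d) (n : Fin d → ℕ) (hn : ∀ i, 1 < n i) :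
    GridPatrol.Patrols n 1 (GridPatrol.makeMove d) (GridPatrol.gridVertices n : Set (Fin d → ℤ)) ∧
    ∀ v₁ ∈ GridPatrol.gridVertices n, ∀ m : GridPatrol.Memory 1,
      ∀ v ∈ GridPatrol.gridVertices n, ∃ t < 2 * (GridPatrol.gridVertices n).card,
        GridPatrol.position n 1 (GridPatrol.makeMove d) v₁ m t = v := by
  refine ⟨fun v₁ hv₁ m => ⟨fun t => ?_, 2 * (GridPatrol.gridVertices n).card, fun v hv => ?_⟩,
    fun v₁ hv₁ m v hv => GridPatrol.exists_position_eq hd hn hv₁ hv m⟩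
  · have hmem := GridPatrol.iterate_step_mem_gridVertices hd hn (s := (v₁, m)) hv₁
    refine ⟨hmem t, hmem (t + 1), ?_⟩
    have := GridPatrol.manhattanDist_step hd hn (hmem t)
    rwa [← Function.iterate_succ_apply' (GridPatrol.step n 1 (GridPatrol.makeMove d))] at this
  · obtain ⟨t, ht, he⟩ := GridPatrol.exists_position_eq hd hn hv₁ hv m
    exact ⟨t, ht.le, he⟩
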